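/- Let $\mathcal F^2$ be the Fock space of entire functions $f$ with $\int_{\mathbb C}|f(z)|^2e^{-|z|^2}\,dV(z)<\infty$, with inner product $\langle f,g\rangle=\frac1\pi\int_{\mathbb C}f(z)\overline{g(z)}e^{-|z|^2}\,dV(z)$. A multi-valued linear operator $S$ on $\mathcal F^2$ is given by its graph $G(S)$, a linear subspace of $\mathcal F^2\times\mathcal F^2$. For a map $T:\mathcal F^2\to\mathcal F^2$, the $T$-adjoint $S_T^*$ has the graph $$G(S_T^*)=\{(u,v)\in\mathcal F^2\times\mathcal F^2:\ \langle g,Tu\rangle=\langle f,Tv\rangle\ \text{ for all }(f,g)\in G(S)\},$$ and $S^*$ denotes the adjoint for $T$ the identity. $S$ is hermitian if $G(S^*)=G(S)$, and $T$-selfadjoint if $G(S_T^*)=G(S)$. For $a,b,c\in\mathbb C$ with $|a|=1$, $\bar a b+\bar b=0$, $|c|^2e^{|b|^2}=1$, let $\mathcal C_{a,b,c}f(z)=ce^{bz}\overline{f(\overline{az+b})}$ on $\mathcal F^2$. Let $m\ge 0$ be an integer and let $\psi,\varphi,\phi$ be entire functions such that $\psi$ has no zeros and $\phi\not\equiv0$;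 if $m\ge1$, suppose also that $\varphi$ is not constant. Let $S$ be a multi-valued weighted composition operator induced by $\psi,\varphi,\phi$ and $m$, that is, a multi-valued linear operator on $\mathcal F^2$ (not necessarily maximal) such that every $(f,g)\in G(S)$ satisfies $$\psi(z)\,f(\varphi(z))=\phi(z)\,g^{(m)}(z)\qquad(z\in\mathbb C).$$ If $S$ is hermitian, then there are $A\in\mathbb R$, $C\in\mathbb R\setminus\{0\}$ and $B\in\mathbb C$ with $$\varphi(z)=Az+B,\qquad Ce^{\overline B z}\phi(z)=\psi(z)(Az+B)^m\qquad(z\in\mathbb C),$$ such that $S$ is $\mathcal C_{a,b,c}$-selfadjoint with $a=\overline B/B$, $b=0$, $c=1$ if $B\ne0$, and with $a=1$, $b=0$, $c=1$ if $B=0$. -/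

import Mathlib

open MeasureTheory ComplexConjugate

namespace Fock

/-- The Fock (Segal-Bargmann) space: entire functions that are square integrable with respect to
the Gaussian weight `exp (-|z|^2)` on the plane. -/
def FockSpace : Submodule ℂ (ℂ → ℂ) where
  carrier := {f | Differentiable ℂ f ∧
    Integrable (fun z : ℂ => ‖f z‖ ^ 2 * Real.exp (-‖z‖ ^ 2)) volume}
  zero_mem' := by
    refine ⟨differentiable_const 0, ?_⟩
    simp
  add_mem' := by
    rintro f g ⟨hf, hfi⟩ ⟨hg, hgi⟩
    refine ⟨hf.add hg, ?_⟩
    refine Integrable.mono' ((hfi.add hgi).const_mul 2) ?_ ?_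
    · have := (hf.add hg).continuous
      exact Continuous.aestronglyMeasurable (by fun_prop)
    · refine Filter.Eventually.of_forall fun z => ?_
      have h1 : ‖f z + g z‖ ^ 2 ≤ 2 * (‖f z‖ ^ 2 + ‖g z‖ ^ 2) := by
        have := norm_add_le (f z) (g z)
        nlinarith [norm_nonneg (f z + g z), sq_nonneg (‖f z‖ - ‖g z‖)]
      have h2 := Real.exp_nonneg (-‖z‖ ^ 2)
      rw [Real.norm_of_nonneg (by positivity)]
      simp only [Pi.add_apply]
      nlinarith [mul_le_mul_of_nonneg_right h1 h2]
  smul_mem' := by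
    rintro c f ⟨hf, hfi⟩
    refine ⟨hf.const_smul c, ?_⟩
    refine (hfi.const_mul (‖c‖ ^ 2)).congr (Filter.Eventually.of_forall fun z => ?_)
    simp only [Pi.smul_apply, smul_eq_mul, norm_mul]
    ring

/-- The inner product of the Fock space, linear in the first variable:
`⟨f, g⟩ = π⁻¹ ∫ f(z) conj(g(z)) exp (-|z|^2) dV(z)`. -/
noncomputable def fockInner (f g : FockSpace) : ℂ :=
  ((Real.pi : ℂ))⁻¹ *
    ∫ z : ℂ, (f : ℂ → ℂ) z * conj ((g : ℂ → ℂ) z) * ((Real.exp (-‖z‖ ^ 2) : ℝ) : ℂ)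

/-- A multi-valued linear operator (linear relation) on the Fock space, identified with its graph
`{(x, y) | x ∈ dom A, y ∈ A x}`, a linear subspace of the product. -/
abbrev MultiOp := Submodule ℂ (FockSpace × FockSpace)

/-- The graph of the `T`-adjoint: all `(u, v)` with `⟨g, T u⟩ = ⟨f, T v⟩` for all `(f, g)` in the
graph of `S`. -/
def adjointGraph (S : MultiOp) (T : FockSpace → FockSpace) : Set (FockSpace × FockSpace) :=
  {p | ∀ q ∈ S, fockInner q.2 (T p.1) = fockInner q.1 (T p.2)}

/-- `S` is hermitian: the graph of the adjoint of `S` is the graph of `S`. -/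
def IsHermitian (S : MultiOp) : Prop :=
  adjointGraph S id = (S : Set (FockSpace × FockSpace))

/-- `S` is `T`-selfadjoint: the graph of the `T`-adjoint of `S` is the graph of `S`. -/
def IsConjSelfadjoint (T : FockSpace → FockSpace) (S : MultiOp) : Prop :=
  adjointGraph S T = (S : Set (FockSpace × FockSpace))

/-- The maximal multi-valued weighted composition operator of order `m` with symbols
`ψ, φ, χ`: all pairs `(f, g)` in the Fock space with `ψ · (f ∘ φ) = χ · g^{(m)}`. -/
noncomputable def maxOp (m : ℕ) (ψ φ χ : ℂ → ℂ) : MultiOp where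
  carrier := {p | ∀ z : ℂ,
    ψ z * (p.1 : ℂ → ℂ) (φ z) = χ z * iteratedDeriv m (p.2 : ℂ → ℂ) z}
  zero_mem' := by
    intro z
    have : iteratedDeriv m (0 : ℂ → ℂ) z = 0 := by
      simp [show (0 : ℂ → ℂ) = fun _ => 0 from rfl]
    simp [this]
  add_mem' := by
    intro p q hp hq z
    have h1 : ContDiff ℂ m (p.2 : ℂ → ℂ) := p.2.2.1.contDiff
    have h2 : ContDiff ℂ m (q.2 : ℂ → ℂ) := q.2.2.1.contDiff
    have h3 := iteratedDeriv_add (x := z) h1.contDiffAt h2.contDiffAt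
    have e1 : ((p + q).1 : ℂ → ℂ) (φ z) = (p.1 : ℂ → ℂ) (φ z) + (q.1 : ℂ → ℂ) (φ z) := rfl
    have e2 : ((p + q).2 : ℂ → ℂ) = (p.2 : ℂ → ℂ) + (q.2 : ℂ → ℂ) := rfl
    rw [e1, e2, h3, mul_add, mul_add, hp z, hq z]
  smul_mem' := by
    intro c p hp z
    have h1 : ContDiff ℂ m (p.2 : ℂ → ℂ) := p.2.2.1.contDiff
    have h3 := iteratedDeriv_const_smul (x := z) h1.contDiffAt c
    have e1 : ((c • p).1 : ℂ → ℂ) (φ z) = c * (p.1 : ℂ → ℂ) (φ z) := rfl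
    have e2 : ((c • p).2 : ℂ → ℂ) = c • (p.2 : ℂ → ℂ) := rfl
    have h4 := hp z
    rw [e1, e2, h3, smul_eq_mul, mul_left_comm, h4, mul_left_comm]

/-- `S` is a (maximal or non-maximal) multi-valued weighted composition operator induced by
the equation `ψ · (f ∘ φ) = χ · g^{(m)}`: every pair in its graph satisfies the equation. -/
def IsWeightedCompOp (m : ℕ) (ψ φ χ : ℂ → ℂ) (S : MultiOp) : Prop :=
  S ≤ maxOp m ψ φ χ

/-- The conditions on `a, b, c` under which the weighted composition conjugation is defined. -/
structure ConjParams (a b c : ℂ) : Prop where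
  norm_a : ‖a‖ = 1
  rel : conj a * b + conj b = 0
  norm_c : ‖c‖ ^ 2 * Real.exp (‖b‖ ^ 2) = 1

/-- `z ↦ conj (a z + b)` preserves Lebesgue measure when `|a| = 1`. -/
theorem measurePreserving_conj_affine {a : ℂ} (ha : ‖a‖ = 1) (b : ℂ) :
    MeasurePreserving (fun z : ℂ => conj (a * z + b)) volume volume := by
  have h1 : MeasurePreserving (fun z : ℂ => a * z) volume volume :=
    (rotation ⟨a, by simp [Submonoid.unitSphere, ha]⟩).measurePreserving
  have h2 : MeasurePreserving (fun z : ℂ => z + b) volume volume :=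
    measurePreserving_add_right volume b
  have h3 : MeasurePreserving (fun z : ℂ => conj z) volume volume :=
    Complex.conjLIE.measurePreserving
  exact h3.comp (h2.comp h1)

/-- The weighted composition conjugation maps the Fock space to itself. -/
theorem weightedConj_mem {a b c : ℂ} (h : ConjParams a b c) (f : FockSpace) :
    (fun z : ℂ => c * Complex.exp (b * z) * conj ((f : ℂ → ℂ) (conj (a * z + b)))) ∈
      FockSpace := by
  obtain ⟨hf, hfi⟩ := f.2
  constructor
  · have h1 : Differentiable ℂ (fun w : ℂ => conj ((f : ℂ → ℂ) (conj w))) := fun w => by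
      have := (hf (conj w)).conj_conj
      rwa [Complex.conj_conj] at this
    have h2 : Differentiable ℂ (fun z : ℂ => conj ((f : ℂ → ℂ) (conj (a * z + b)))) :=
      h1.comp (by fun_prop : Differentiable ℂ (fun z : ℂ => a * z + b))
    have h3 : Differentiable ℂ (fun z : ℂ => c * Complex.exp (b * z)) := by fun_prop
    exact h3.mul h2
  · have hmp := measurePreserving_conj_affine h.norm_a b
    have h1 := hmp.integrable_comp_of_integrable hfi
    refine h1.congr (Filter.Eventually.of_forall fun z => ?_)
    have hb : b = -(a * conj b) := by
      have := congrArg conj h.rel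
      simp only [map_add, map_mul, Complex.conj_conj, map_zero] at this
      linear_combination this
    have key : ‖conj (a * z + b)‖ ^ 2 = ‖z‖ ^ 2 - 2 * (b * z).re + ‖b‖ ^ 2 := by
      have e1 : (a * z * conj b).re = -(b * z).re := by
        have : a * z * conj b = -(b * z) := by linear_combination z * hb
        rw [this, Complex.neg_re]
      rw [Complex.norm_conj, Complex.sq_norm, Complex.normSq_add, e1, ← Complex.sq_norm,
        ← Complex.sq_norm, norm_mul, h.norm_a]
      ring
    simp only [Function.comp, norm_mul, Complex.norm_exp, Complex.norm_conj, mul_pow]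
    rw [Complex.norm_conj] at key
    rw [key]
    have e2 : Real.exp (-(‖z‖ ^ 2 - 2 * (b * z).re + ‖b‖ ^ 2)) * Real.exp (‖b‖ ^ 2)
        = Real.exp ((b * z).re) ^ 2 * Real.exp (-‖z‖ ^ 2) := by
      rw [← Real.exp_add, ← Real.exp_nat_mul, ← Real.exp_add]
      congr 1
      push_cast
      ring
    have hc := h.norm_c
    linear_combination (-(‖(f : ℂ → ℂ) (conj (a * z + b))‖ ^ 2 *
      Real.exp (-(‖z‖ ^ 2 - 2 * (b * z).re + ‖b‖ ^ 2)))) * hc +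
      ‖c‖ ^ 2 * ‖(f : ℂ → ℂ) (conj (a * z + b))‖ ^ 2 * e2

/-- The weighted composition conjugation
`(C_{a,b,c} f)(z) = c exp (b z) conj (f (conj (a z + b)))`. -/
noncomputable def weightedConj {a b c : ℂ} (h : ConjParams a b c) (f : FockSpace) : FockSpace :=
  ⟨fun z => c * Complex.exp (b * z) * conj ((f : ℂ → ℂ) (conj (a * z + b))),
    weightedConj_mem h f⟩

/-- `S` is `C_{a,b,c}`-selfadjoint (with admissible parameters `a, b, c`). -/
def IsCSelfadjoint (a b c : ℂ) (S : MultiOp) : Prop :=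
  ∃ h : ConjParams a b c, IsConjSelfadjoint (weightedConj h) S

end Fock

namespace Fock

open Filter Topology AddCircle

/-! ### Fourier coefficients of power series on circles -/

/-! By the reproducing property, the defining equation at a point `w` says that (f, g) annihilates a
pair built from kernels: conj(χ(w)) z^m exp(conj(w) z) and conj(ψ(w)) exp(conj(φ(w)) z). These pairs
lie in the graph of the adjoint, hence in the graph of a hermitian `S`, so they satisfy the defining
equation themselves. The result is a functional equation in two variables (`functional_equation`),
and analyticity forces its solutions to be φ(z) = Az + B with the stated relation between χ and ψ
(`symbols_of_functional_equation`).

With these symbols the maximal operator is symmetric (`ReducedEq.pairing_eq`). Hence it is contained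
in S* = S, and S equals the maximal operator (`isHermitian_eq_maxOp`). The isometry f(z) ↦
conj(f(conj(az))) preserves the maximal graph as soon as aB = conj(B) (`reducedEq_conj_iff`). Since
(u, v) lies in the T-adjoint exactly when (Tu, Tv) lies in S* = S, the conjugate selfadjointness
follows.

The analytic work is the symmetry for A ≠ 0. There f is a real multiple of Lg, where L is the
possibly unbounded operator `weightedDeriv`. On exponentials, symmetry is the reproducing property.
For a dilate v(sz) with |s| = r < 1, both pairings expand in powers of s, with the Taylor
coefficients of v multiplying quantities that do not depend on v; the exponential case shows that
these quantities agree, which gives symmetry for every dilate (`pairing_dilation_weightedDeriv`).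
Finally r → 1: the norms of v(rz) and of L(v(r·)) stay bounded, so pointwise convergence becomes
weak convergence (`tendsto_pairing_of_bounded`). -/

theorem norm_fourier_apply (n : ℤ) (x : UnitAddCircle) : ‖(fourier n x : ℂ)‖ = 1 := by
  rw [fourier_apply]
  exact Circle.norm_coe _

theorem fourierCoeff_of_hasSum {a : ℕ → ℂ} {F : UnitAddCircle → ℂ}
    (ha : Summable fun k => ‖a k‖) (hF : ∀ x, HasSum (fun k : ℕ => a k * fourier (k : ℤ) x) (F x))
    (n : ℤ) : fourierCoeff F n = if 0 ≤ n then a n.toNat else 0 := by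
  have h1 : ∀ k : ℕ, Integrable (fun x : UnitAddCircle =>
      fourier (-n) x • (a k * fourier (k : ℤ) x)) haarAddCircle := fun k =>
    ((map_continuous (fourier (-n))).smul
      (continuous_const.mul (map_continuous (fourier (k : ℤ))))).integrable_of_hasCompactSupport
        (HasCompactSupport.of_compactSpace _)
  have h2 : ∀ k : ℕ, ∫ x : UnitAddCircle, ‖fourier (-n) x • (a k * fourier (k : ℤ) x)‖
      ∂haarAddCircle = ‖a k‖ := fun k => by
    simp only [norm_smul, norm_mul, norm_fourier_apply, mul_one, one_mul]
    simp
  have h3 := hasSum_integral_of_summable_integral_norm h1 (by simpa only [h2] using ha)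
  have h4 : ∀ k : ℕ, ∫ x : UnitAddCircle, fourier (-n) x • (a k * fourier (k : ℤ) x)
      ∂haarAddCircle = if (k : ℤ) = n then a k else 0 := fun k => by
    have e : fourierCoeff (fun x : UnitAddCircle => a k * fourier (k : ℤ) x) n
        = if (k : ℤ) = n then a k else 0 := by
      rw [fourierCoeff.const_mul, fourierCoeff_fourier]
      by_cases h : (k : ℤ) = n
      · subst h; simp
      · simp [h, Ne.symm h]
    exact e
  have h5 : ∀ x : UnitAddCircle, ∑' k : ℕ, fourier (-n) x • (a k * fourier (k : ℤ) x)
      = fourier (-n) x • F x := fun x => ((hF x).const_smul (fourier (-n) x)).tsum_eq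
  simp only [h4, h5] at h3
  change HasSum _ (fourierCoeff F n) at h3
  refine h3.unique ?_
  split_ifs with hn
  · convert hasSum_ite_eq n.toNat (a n.toNat) using 2 with k
    by_cases h : (k : ℤ) = n
    · have : k = n.toNat := by omega
      rw [if_pos h, if_pos this, this]
    · have : k ≠ n.toNat := by omega
      rw [if_neg h, if_neg this]
  · convert hasSum_zero with k
    have : (k : ℤ) ≠ n := by omega
    simp [this]

theorem fourier_one_pow (k : ℕ) (x : UnitAddCircle) :
    (fourier 1 x : ℂ) ^ k = fourier (k : ℤ) x := by
  simp [fourier_apply, toCircle_nsmul]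

theorem fourierCoeff_comp_circle {a : ℕ → ℂ} {F : ℂ → ℂ}
    (hF : ∀ s, HasSum (fun k => a k * s ^ k) (F s)) (r : ℂ) (n : ℤ) :
    fourierCoeff (fun x : UnitAddCircle => F (r * fourier 1 x)) n =
      if 0 ≤ n then a n.toNat * r ^ n.toNat else 0 := by
  refine fourierCoeff_of_hasSum (a := fun k => a k * r ^ k) (hF r).summable.norm (fun x => ?_) n
  convert hF (r * fourier 1 x) using 2 with k
  rw [mul_pow, fourier_one_pow, mul_assoc]

theorem hasSum_taylor {f : ℂ → ℂ} (hf : Differentiable ℂ f) (z : ℂ) :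
    HasSum (fun n : ℕ => iteratedDeriv n f 0 / (n.factorial : ℂ) * z ^ n) (f z) := by
  have h := Complex.hasSum_taylorSeries_of_entire hf 0 z
  simp only [sub_zero, smul_eq_mul] at h
  refine h.congr_fun fun n => ?_
  ring

/-- The zero sequence is summable, so the Fourier series converges pointwise to F. -/
theorem eq_zero_of_fourierCoeff_eq_zero {F : UnitAddCircle → ℂ} (hF : Continuous F)
    (h : ∀ n, fourierCoeff F n = 0) (x : UnitAddCircle) : F x = 0 := by
  have h0 : fourierCoeff F = 0 := funext h
  have h1 := has_pointwise_sum_fourier_series_of_summable (f := ⟨F, hF⟩)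
    (by rw [ContinuousMap.coe_mk, h0]; exact summable_zero) x
  simp only [ContinuousMap.coe_mk, h, zero_smul] at h1
  exact h1.unique hasSum_zero

theorem fourierCoeff_integral {Φ : UnitAddCircle → ℂ → ℂ}
    (h : Integrable (Function.uncurry Φ) (haarAddCircle.prod volume)) (n : ℤ) :
    fourierCoeff (fun x => ∫ z, Φ x z) n = ∫ z, fourierCoeff (fun x => Φ x z) n := by
  have h1 : Integrable (Function.uncurry fun x z => (fourier (-n) x : ℂ) • Φ x z)
      (haarAddCircle.prod volume) := by
    refine h.bdd_mul (c := 1) (f := fun p : UnitAddCircle × ℂ => (fourier (-n) p.1 : ℂ)) ?_ ?_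
    · exact ((map_continuous (fourier (-n))).comp continuous_fst).aestronglyMeasurable
    · exact Eventually.of_forall fun p => (norm_fourier_apply _ _).le
  have h2 := integral_integral_swap h1
  simp only [integral_smul] at h2
  exact h2

theorem integrable_uncurry_of_dominated {Φ : UnitAddCircle → ℂ → ℂ} {b : ℂ → ℝ}
    (hc : Continuous (Function.uncurry Φ)) (hb : Integrable b) (h : ∀ x z, ‖Φ x z‖ ≤ b z) :
    Integrable (Function.uncurry Φ) (haarAddCircle.prod volume) :=
  (hb.comp_snd haarAddCircle).mono' hc.aestronglyMeasurable
    (Eventually.of_forall fun p => h p.1 p.2)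

/-! ### Gaussian integrability -/

theorem integrable_exp_neg_mul_norm_sq {ε : ℝ} (hε : 0 < ε) :
    Integrable fun z : ℂ => Real.exp (-ε * ‖z‖ ^ 2) :=
  .of_integral_ne_zero (by
    rw [GaussianFourier.integral_rexp_neg_mul_sq_norm hε]
    positivity)

theorem integrable_exp_mul_norm_sub_sq (K : ℝ) {ε : ℝ} (hε : 0 < ε) :
    Integrable fun z : ℂ => Real.exp (K * ‖z‖ - ε * ‖z‖ ^ 2) := by
  refine ((integrable_exp_neg_mul_norm_sq (half_pos hε)).const_mul
    (Real.exp (K ^ 2 / (2 * ε)))).mono' (by fun_prop) (Eventually.of_forall fun z => ?_)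
  rw [Real.norm_of_nonneg (Real.exp_nonneg _), ← Real.exp_add]
  refine Real.exp_le_exp.2 ?_
  have : K ^ 2 / (2 * ε) - K * ‖z‖ + ε / 2 * ‖z‖ ^ 2 = (K - ε * ‖z‖) ^ 2 / (2 * ε) := by
    field_simp
    ring
  have : 0 ≤ (K - ε * ‖z‖) ^ 2 / (2 * ε) := by positivity
  linarith

theorem pow_le_factorial_mul_exp (m : ℕ) {x : ℝ} (hx : 0 ≤ x) :
    x ^ m ≤ m.factorial * Real.exp x := by
  have := Real.pow_div_factorial_le_exp x hx m
  rwa [div_le_iff₀' (by positivity)] at this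

theorem mem_of_norm_le {f : ℂ → ℂ} (hf : Differentiable ℂ f) {M K ε : ℝ} (hε : ε < 1 / 2)
    (h : ∀ z, ‖f z‖ ≤ M * Real.exp (K * ‖z‖ + ε * ‖z‖ ^ 2)) : f ∈ FockSpace := by
  refine ⟨hf, ?_⟩
  refine ((integrable_exp_mul_norm_sub_sq (2 * K) (ε := 1 - 2 * ε) (by linarith)).const_mul
    (M ^ 2)).mono' ?_ (Eventually.of_forall fun z => ?_)
  · have := hf.continuous
    exact Continuous.aestronglyMeasurable (by fun_prop)
  · rw [Real.norm_of_nonneg (by positivity)]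
    calc ‖f z‖ ^ 2 * Real.exp (-‖z‖ ^ 2)
        ≤ (M * Real.exp (K * ‖z‖ + ε * ‖z‖ ^ 2)) ^ 2 * Real.exp (-‖z‖ ^ 2) := by
          gcongr
          exact h z
      _ = M ^ 2 * Real.exp (2 * K * ‖z‖ - (1 - 2 * ε) * ‖z‖ ^ 2) := by
          rw [mul_pow, ← Real.exp_nat_mul, mul_assoc, ← Real.exp_add]
          congr 2
          push_cast
          ring

theorem pow_mul_exp_mem (m : ℕ) (c : ℂ) :
    (fun z : ℂ => z ^ m * Complex.exp (c * z)) ∈ FockSpace := by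
  refine mem_of_norm_le (M := m.factorial) (K := 1 + ‖c‖) (ε := 0) (by fun_prop) (by norm_num)
    fun z => ?_
  rw [norm_mul, norm_pow, Complex.norm_exp, zero_mul, add_zero, add_mul, one_mul, Real.exp_add,
    ← mul_assoc]
  gcongr
  · exact pow_le_factorial_mul_exp m (norm_nonneg z)
  · exact (Complex.re_le_norm _).trans (norm_mul _ _).le

theorem integrable_mul_conj {f g : ℂ → ℂ} (hf : f ∈ FockSpace) (hg : g ∈ FockSpace) :
    Integrable fun z : ℂ => f z * conj (g z) * ((Real.exp (-‖z‖ ^ 2) : ℝ) : ℂ) := by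
  refine (hf.2.add hg.2).mono' ?_ (Eventually.of_forall fun z => ?_)
  · have h1 := hf.1.continuous
    have h2 := hg.1.continuous
    exact Continuous.aestronglyMeasurable (by fun_prop)
  · rw [norm_mul, norm_mul, RCLike.norm_conj, Complex.norm_real,
      Real.norm_of_nonneg (Real.exp_nonneg _)]
    simp only [Pi.add_apply]
    rw [← add_mul]
    gcongr
    nlinarith [sq_nonneg (‖f z‖ - ‖g z‖), sq_nonneg (‖f z‖ + ‖g z‖)]

/-- The unnormalised inner product of the Fock space. -/
noncomputable def pairing (f g : ℂ → ℂ) : ℂ :=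
  ∫ z : ℂ, f z * conj (g z) * ((Real.exp (-‖z‖ ^ 2) : ℝ) : ℂ)

theorem pairing_conj_symm (f g : ℂ → ℂ) : conj (pairing f g) = pairing g f := by
  unfold pairing
  rw [← integral_conj]
  congr 1
  ext z
  simp only [map_mul, Complex.conj_conj, Complex.conj_ofReal]
  ring

/-! ### The reproducing property -/

theorem measurePreserving_mul_left {a : ℂ} (ha : ‖a‖ = 1) :
    MeasurePreserving (fun z : ℂ => a * z) volume volume :=
  (rotation ⟨a, by simp [Submonoid.unitSphere, ha]⟩).measurePreserving

theorem integral_comp_rotation {E : Type*} [NormedAddCommGroup E] [NormedSpace ℝ E] {F : ℂ → E}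
    {a : ℂ} (ha : ‖a‖ = 1) : ∫ z, F (a * z) = ∫ z, F z :=
  (measurePreserving_mul_left ha).integral_comp
    (Homeomorph.mulLeft₀ a (by rintro rfl; simp at ha)).measurableEmbedding F

theorem integral_norm_pow_mul_exp (n : ℕ) :
    ∫ z : ℂ, ‖z‖ ^ (2 * n) * Real.exp (-‖z‖ ^ 2) = Real.pi * n.factorial := by
  have h := Complex.integral_rpow_mul_exp_neg_rpow (p := 2) (q := (2 * n : ℕ)) (by norm_num)
    (by have : (0 : ℝ) ≤ ((2 * n : ℕ) : ℝ) := by positivity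
        linarith)
  simp only [Real.rpow_natCast, Real.rpow_two] at h
  rw [h, ← Real.Gamma_nat_eq_factorial]
  push_cast
  ring_nf

/-- Rotating the plane multiplies the pairing by a character of degree n, so averaging against that
character extracts the n-th Taylor term of f before integrating over the plane. This avoids
exchanging the Taylor series with the Gaussian integral. -/
theorem pairing_pow {f : ℂ → ℂ} (hf : f ∈ FockSpace) (n : ℕ) :
    pairing f (fun z => z ^ n) = Real.pi * iteratedDeriv n f 0 := by
  have hp : (fun z : ℂ => z ^ n) ∈ FockSpace := by simpa using pow_mul_exp_mem n 0
  have hint := integrable_mul_conj hf hp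
  -- Only f is rotated. The leading factor 1 is the radius expected by `fourierCoeff_comp_circle`.
  set Φ : UnitAddCircle → ℂ → ℂ := fun x z =>
    f (1 * fourier 1 x * z) * (conj (z ^ n) * ((Real.exp (-‖z‖ ^ 2) : ℝ) : ℂ)) with hΦ
  have hcont : Continuous (Function.uncurry Φ) := by
    have h1 := hf.1.continuous
    have h2 : Continuous fun p : UnitAddCircle × ℂ => (fourier 1 p.1 : ℂ) :=
      (map_continuous (fourier 1)).comp continuous_fst
    have h3 : Continuous fun p : UnitAddCircle × ℂ => f (1 * fourier 1 p.1 * p.2) :=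
      h1.comp (by fun_prop)
    exact h3.mul (by fun_prop)
  have hval : ∀ x z, Φ x z = fourier (n : ℤ) x *
      (f (fourier 1 x * z) * conj ((fourier 1 x * z) ^ n) *
        ((Real.exp (-‖fourier 1 x * z‖ ^ 2) : ℝ) : ℂ)) := by
    intro x z
    have e1 : (fourier (n : ℤ) x : ℂ) * conj ((fourier 1 x : ℂ) ^ n) = 1 := by
      rw [fourier_one_pow, Complex.mul_conj, Complex.normSq_eq_norm_sq, norm_fourier_apply]
      simp
    simp only [hΦ, mul_pow, map_mul, norm_mul, norm_fourier_apply, one_mul]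
    linear_combination (-(f (fourier 1 x * z) * conj (z ^ n) *
      ((Real.exp (-‖z‖ ^ 2) : ℝ) : ℂ))) * e1
  have hintx : ∀ x, Integrable (Φ x) := fun x => by
    have h2 := ((measurePreserving_mul_left (norm_fourier_apply 1 x)).integrable_comp_of_integrable hint).const_mul (fourier (n : ℤ) x : ℂ)
    refine h2.congr (Eventually.of_forall fun z => (hval x z).symm)
  have hΦint : Integrable (Function.uncurry Φ) (haarAddCircle.prod volume) := by
    rw [integrable_prod_iff hcont.aestronglyMeasurable]
    refine ⟨Eventually.of_forall fun x => hintx x, ?_⟩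
    refine (integrable_const (∫ z, ‖f z * conj (z ^ n) *
      ((Real.exp (-‖z‖ ^ 2) : ℝ) : ℂ)‖)).congr (Eventually.of_forall fun x => ?_)
    have : ∀ z, ‖Function.uncurry Φ (x, z)‖ = ‖f (fourier 1 x * z) * conj ((fourier 1 x * z) ^ n) *
        ((Real.exp (-‖fourier 1 x * z‖ ^ 2) : ℝ) : ℂ)‖ := fun z => by
      rw [Function.uncurry_apply_pair, hval, norm_mul _ (_ * _), norm_fourier_apply, one_mul]
    simp only [this]
    exact (integral_comp_rotation (F := fun z => ‖f z * conj (z ^ n) *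
      ((Real.exp (-‖z‖ ^ 2) : ℝ) : ℂ)‖) (norm_fourier_apply 1 x)).symm
  have key := fourierCoeff_integral hΦint n
  have hl : fourierCoeff (fun x => ∫ z, Φ x z) n = pairing f (fun z => z ^ n) := by
    have : (fun x => ∫ z, Φ x z) = fun x => pairing f (fun z => z ^ n) * fourier (n : ℤ) x := by
      ext x
      simp only [hval]
      rw [integral_const_mul, integral_comp_rotation (F := fun z => f z * conj (z ^ n) *
        ((Real.exp (-‖z‖ ^ 2) : ℝ) : ℂ)) (norm_fourier_apply 1 x), mul_comm]
      rfl
    rw [this, fourierCoeff.const_mul, fourierCoeff_fourier]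
    simp
  have hr : ∀ z, fourierCoeff (fun x => Φ x z) n =
      iteratedDeriv n f 0 / (n.factorial : ℂ) *
        ((‖z‖ ^ (2 * n) * Real.exp (-‖z‖ ^ 2) : ℝ) : ℂ) := fun z => by
    have h1 := fourierCoeff_comp_circle (F := fun s => f (s * z) *
      (conj (z ^ n) * ((Real.exp (-‖z‖ ^ 2) : ℝ) : ℂ)))
      (a := fun k => iteratedDeriv k f 0 / (k.factorial : ℂ) * z ^ k *
        (conj (z ^ n) * ((Real.exp (-‖z‖ ^ 2) : ℝ) : ℂ))) (fun s => by
        refine ((hasSum_taylor hf.1 (s * z)).mul_right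
          (conj (z ^ n) * ((Real.exp (-‖z‖ ^ 2) : ℝ) : ℂ))).congr_fun fun k => ?_
        ring) 1 n
    rw [h1]
    have e : z ^ n * conj (z ^ n) = ((‖z‖ ^ (2 * n) : ℝ) : ℂ) := by
      rw [Complex.mul_conj, Complex.normSq_eq_norm_sq, norm_pow, ← pow_mul, mul_comm n]
    simp only [Int.natCast_nonneg, if_true, Int.toNat_natCast, one_pow, mul_one]
    rw [Complex.ofReal_mul, ← e]
    ring
  rw [hl] at key
  simp only [hr] at key
  rw [key, integral_const_mul, integral_complex_ofReal, integral_norm_pow_mul_exp]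
  have : (n.factorial : ℂ) ≠ 0 := by exact_mod_cast n.factorial_ne_zero
  push_cast
  field_simp

theorem differentiable_iteratedDeriv {f : ℂ → ℂ} (hf : Differentiable ℂ f) (m : ℕ) :
    Differentiable ℂ (iteratedDeriv m f) :=
  (hf.contDiff (n := (m + 1 : ℕ))).differentiable_iteratedDeriv m (by norm_cast; omega)

theorem iteratedDeriv_comp_affine {f : ℂ → ℂ} (hf : Differentiable ℂ f) (a b : ℂ) (m : ℕ) :
    iteratedDeriv m (fun z => f (a * z + b)) = fun z => a ^ m * iteratedDeriv m f (a * z + b) := by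
  induction m with
  | zero => simp
  | succ m ih =>
    ext z
    rw [iteratedDeriv_succ, ih, iteratedDeriv_succ]
    have h1 : HasDerivAt (fun z => a * z + b) a z := by
      simpa using ((hasDerivAt_id z).const_mul a).add_const b
    have h2 := ((differentiable_iteratedDeriv hf m) (a * z + b)).hasDerivAt.comp z h1
    refine (h2.const_mul (a ^ m)).deriv.trans ?_
    ring

theorem iteratedDeriv_iteratedDeriv (f : ℂ → ℂ) (k m : ℕ) :
    iteratedDeriv k (iteratedDeriv m f) = iteratedDeriv (k + m) f := by
  simp only [iteratedDeriv_eq_iterate, Function.iterate_add_apply]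

/-! ### Gaussian-weighted translations, kernels at arbitrary points, pointwise growth. -/

theorem norm_add_sq_eq (z w : ℂ) :
    ‖z + w‖ ^ 2 = ‖z‖ ^ 2 + ‖w‖ ^ 2 + 2 * (conj w * z).re := by
  rw [Complex.sq_norm, Complex.normSq_add, ← Complex.sq_norm, ← Complex.sq_norm, mul_comm z]

theorem norm_sq_shift (f : ℂ → ℂ) (w z : ℂ) :
    ‖f (z + w) * Complex.exp (-conj w * z)‖ ^ 2 * Real.exp (-‖z‖ ^ 2) =
      Real.exp (‖w‖ ^ 2) * (‖f (z + w)‖ ^ 2 * Real.exp (-‖z + w‖ ^ 2)) := by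
  rw [norm_mul, mul_pow, Complex.norm_exp, ← Real.exp_nat_mul, mul_assoc, ← Real.exp_add,
    mul_left_comm, ← Real.exp_add, norm_add_sq_eq, neg_mul, Complex.neg_re]
  congr 2
  push_cast
  ring

theorem shift_mem {f : ℂ → ℂ} (hf : f ∈ FockSpace) (w : ℂ) :
    (fun z => f (z + w) * Complex.exp (-conj w * z)) ∈ FockSpace := by
  have h1 := hf.1
  refine ⟨by fun_prop, ?_⟩
  simp only [norm_sq_shift]
  exact (hf.2.comp_add_right w).const_mul _

theorem integral_norm_sq_shift (f : ℂ → ℂ) (w : ℂ) :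
    ∫ z, ‖f (z + w) * Complex.exp (-conj w * z)‖ ^ 2 * Real.exp (-‖z‖ ^ 2) =
      Real.exp (‖w‖ ^ 2) * ∫ z, ‖f z‖ ^ 2 * Real.exp (-‖z‖ ^ 2) := by
  simp only [norm_sq_shift]
  rw [integral_const_mul, integral_add_right_eq_self (fun z => ‖f z‖ ^ 2 * Real.exp (-‖z‖ ^ 2)) w]

theorem pow_mem (n : ℕ) : (fun z : ℂ => z ^ n) ∈ FockSpace := by
  simpa using pow_mul_exp_mem n 0

/-- The reproducing property of the derivatives of the kernel functions. -/
theorem pairing_kernel {f : ℂ → ℂ} (hf : f ∈ FockSpace) (m : ℕ) (w : ℂ) :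
    pairing f (fun z => z ^ m * Complex.exp (conj w * z)) = Real.pi * iteratedDeriv m f w := by
  set F : ℂ → ℂ := fun z => f (z + w) * Complex.exp (-conj w * z) with hF
  have hFm : F ∈ FockSpace := shift_mem hf w
  have h1 : pairing f (fun z => z ^ m * Complex.exp (conj w * z)) =
      ∫ z, F z * conj ((z + w) ^ m) * ((Real.exp (-‖z‖ ^ 2) : ℝ) : ℂ) := by
    unfold pairing
    rw [← integral_add_right_eq_self _ w]
    congr 1
    ext z
    have e : conj (Complex.exp (conj w * (z + w))) * ((Real.exp (-‖z + w‖ ^ 2) : ℝ) : ℂ) =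
        Complex.exp (-conj w * z) * ((Real.exp (-‖z‖ ^ 2) : ℝ) : ℂ) := by
      rw [← Complex.exp_conj, Complex.ofReal_exp, Complex.ofReal_exp, ← Complex.exp_add,
        ← Complex.exp_add]
      congr 1
      push_cast
      rw [← Complex.mul_conj', ← Complex.mul_conj']
      simp only [map_mul, map_add, Complex.conj_conj]
      ring
    simp only [hF, map_mul]
    linear_combination (f (z + w) * conj ((z + w) ^ m)) * e
  have h2 : ∀ z, F z * conj ((z + w) ^ m) * ((Real.exp (-‖z‖ ^ 2) : ℝ) : ℂ) =
      ∑ k ∈ Finset.range (m + 1), (conj w ^ (m - k) * (m.choose k : ℂ)) *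
        (F z * conj (z ^ k) * ((Real.exp (-‖z‖ ^ 2) : ℝ) : ℂ)) := fun z => by
    rw [add_pow, map_sum, Finset.mul_sum, Finset.sum_mul]
    refine Finset.sum_congr rfl fun k _ => ?_
    simp only [map_mul, map_pow, Complex.conj_natCast]
    ring
  have h3 : ∀ k, ∫ z, F z * conj (z ^ k) * ((Real.exp (-‖z‖ ^ 2) : ℝ) : ℂ) =
      Real.pi * iteratedDeriv k F 0 := pairing_pow hFm
  rw [h1]
  simp only [h2]
  rw [integral_finsetSum _ fun k _ => (integrable_mul_conj hFm (pow_mem k)).const_mul _]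
  simp only [integral_const_mul, h3]
  -- The binomial sum is the Leibniz formula for the m-th derivative at 0 of the product of F and
  -- exp(conj(w) z), and this product is f(z + w).
  have h4 : (F * fun z => Complex.exp (conj w * z)) = fun z => f (1 * z + w) := by
    ext z
    simp only [hF, Pi.mul_apply, one_mul]
    rw [mul_assoc, ← Complex.exp_add]
    simp
  have h5 := iteratedDeriv_mul (n := m) (x := 0) (hFm.1.contDiff (n := m)).contDiffAt
    (show ContDiffAt ℂ m (fun z => Complex.exp (conj w * z)) 0 by fun_prop)
  rw [h4, iteratedDeriv_comp_affine hf.1] at h5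
  simp only [one_pow, one_mul, zero_add, iteratedDeriv_cexp_const_mul, mul_zero, Complex.exp_zero,
    mul_one] at h5
  rw [h5, Finset.mul_sum]
  refine Finset.sum_congr rfl fun k _ => ?_
  ring

/-- The weighted translate F has F(0) = f(w) and squared norm exp(|w|²) times that of f; the mean
value property (`pairing_pow` with n = 0) bounds F(0). -/
theorem exists_norm_le {f : ℂ → ℂ} (hf : f ∈ FockSpace) :
    ∃ M : ℝ, 0 ≤ M ∧ ∀ w, ‖f w‖ ≤ M * Real.exp (‖w‖ ^ 2 / 2) := by
  set N := ∫ z, ‖f z‖ ^ 2 * Real.exp (-‖z‖ ^ 2) with hN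
  set G := ∫ z : ℂ, Real.exp (-1 * ‖z‖ ^ 2) with hG
  have hN0 : 0 ≤ N := integral_nonneg fun z => by positivity
  have hG0 : 0 ≤ G := integral_nonneg fun z => by positivity
  have hπ := Real.pi_pos
  refine ⟨Real.pi⁻¹ * (N + G), by positivity, fun w => ?_⟩
  set F : ℂ → ℂ := fun z => f (z + w) * Complex.exp (-conj w * z) with hF
  have hFm : F ∈ FockSpace := shift_mem hf w
  have h1 := pairing_pow hFm 0
  simp only [iteratedDeriv_zero] at h1
  have hF0 : F 0 = f w := by simp [hF]
  -- The weight in |F| ≤ |F|²/t + t that balances the two terms after integration, each becoming a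
  -- multiple of t.
  set t := Real.exp (‖w‖ ^ 2 / 2) with ht
  have ht0 : 0 < t := Real.exp_pos _
  have htt : Real.exp (‖w‖ ^ 2) = t * t := by
    rw [ht, ← Real.exp_add]
    ring_nf
  have h2 : ‖pairing F (fun z => z ^ 0)‖ ≤ ∫ z, (t⁻¹ * (‖F z‖ ^ 2 * Real.exp (-‖z‖ ^ 2)) +
      t * Real.exp (-1 * ‖z‖ ^ 2)) := by
    refine norm_integral_le_of_norm_le ((hFm.2.const_mul _).add
      ((integrable_exp_neg_mul_norm_sq one_pos).const_mul _)) (Eventually.of_forall fun z => ?_)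
    simp only [pow_zero, map_one, mul_one, norm_mul, Complex.norm_real, neg_one_mul]
    rw [Real.norm_of_nonneg (Real.exp_nonneg _), ← mul_assoc, ← add_mul]
    gcongr
    have : 0 ≤ t⁻¹ * ((‖F z‖ - t) ^ 2 + ‖F z‖ * t) := by positivity
    have e : t⁻¹ * ((‖F z‖ - t) ^ 2 + ‖F z‖ * t) = t⁻¹ * ‖F z‖ ^ 2 + t - ‖F z‖ := by
      field_simp
      ring
    linarith
  rw [integral_add (hFm.2.const_mul _) ((integrable_exp_neg_mul_norm_sq one_pos).const_mul _),
    integral_const_mul, integral_const_mul, integral_norm_sq_shift, htt, h1, hF0, norm_mul,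
    Complex.norm_real, Real.norm_of_nonneg hπ.le] at h2
  have h3 : t⁻¹ * (t * t * N) + t * G = (N + G) * t := by field_simp
  rw [← hN, ← hG, h3] at h2
  rw [mul_assoc, inv_mul_eq_div, le_div_iff₀' hπ]
  exact h2

/-! ### Families depending on a parameter on a circle -/

/-- The hypotheses under which a family of functions can be paired coefficientwise. -/
structure CircleFamily (r : ℝ) (Ψ : ℂ → ℂ → ℂ) : Prop where
  cont : Continuous (Function.uncurry Ψ)
  bound : ∃ M K ε : ℝ, ε < 1 / 2 ∧
    ∀ s z, ‖s‖ = r → ‖Ψ s z‖ ≤ M * Real.exp (K * ‖z‖ + ε * ‖z‖ ^ 2)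

/-- Since g grows at most like exp(|z|²/2), a Gaussian rate ε < 1/2 leaves the decay exp(-(1/2 -
ε)|z|²), uniformly on the circle. -/
theorem CircleFamily.exists_integrable_bound {r : ℝ} {Ψ : ℂ → ℂ → ℂ} (hΨ : CircleFamily r Ψ)
    {g : ℂ → ℂ} (hg : g ∈ FockSpace) : ∃ b : ℂ → ℝ, Integrable b ∧ ∀ s z, ‖s‖ = r →
      ‖Ψ s z * conj (g z) * ((Real.exp (-‖z‖ ^ 2) : ℝ) : ℂ)‖ ≤ b z := by
  obtain ⟨M, K, ε, hε, hb⟩ := hΨ.bound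
  obtain ⟨N, hN0, hN⟩ := exists_norm_le hg
  refine ⟨_, (integrable_exp_mul_norm_sub_sq K (ε := 1 / 2 - ε) (by linarith)).const_mul (M * N),
    fun s z hs => ?_⟩
  rw [norm_mul, norm_mul, RCLike.norm_conj, Complex.norm_real,
    Real.norm_of_nonneg (Real.exp_nonneg _)]
  have hM : 0 ≤ M * Real.exp (K * ‖z‖ + ε * ‖z‖ ^ 2) := (norm_nonneg _).trans (hb s z hs)
  calc _ ≤ (M * Real.exp (K * ‖z‖ + ε * ‖z‖ ^ 2)) * (N * Real.exp (‖z‖ ^ 2 / 2)) *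
        Real.exp (-‖z‖ ^ 2) := by
        gcongr
        · exact hb s z hs
        · exact hN z
    _ = M * N * (Real.exp (K * ‖z‖ + ε * ‖z‖ ^ 2) * Real.exp (‖z‖ ^ 2 / 2) *
        Real.exp (-‖z‖ ^ 2)) := by ring
    _ = _ := by
      rw [← Real.exp_add, ← Real.exp_add]
      congr 2
      ring

theorem continuous_circle_mul (r : ℂ) :
    Continuous fun x : UnitAddCircle => r * (fourier 1 x : ℂ) :=
  continuous_const.mul (map_continuous (fourier 1))

theorem norm_circle_mul {r : ℝ} (hr : 0 ≤ r) (x : UnitAddCircle) :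
    ‖(r : ℂ) * (fourier 1 x : ℂ)‖ = r := by
  rw [norm_mul, norm_fourier_apply, mul_one, Complex.norm_real, Real.norm_of_nonneg hr]

theorem CircleFamily.continuous_pairing {r : ℝ} (hr : 0 ≤ r) {Ψ : ℂ → ℂ → ℂ}
    (hΨ : CircleFamily r Ψ) {g : ℂ → ℂ} (hg : g ∈ FockSpace) :
    Continuous fun x : UnitAddCircle => pairing (Ψ (r * fourier 1 x)) g := by
  obtain ⟨b, hb, h⟩ := hΨ.exists_integrable_bound hg
  have hgc := hg.1.continuous
  refine continuous_of_dominated (bound := b) (fun x => ?_)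
    (fun x => Eventually.of_forall fun z => h _ z (norm_circle_mul hr x)) hb
    (Eventually.of_forall fun z => ?_)
  · have : Continuous fun z => Ψ (r * fourier 1 x) z :=
      hΨ.cont.comp (continuous_const.prodMk continuous_id)
    exact Continuous.aestronglyMeasurable (by fun_prop)
  · have : Continuous fun x : UnitAddCircle => Ψ (r * fourier 1 x) z :=
      hΨ.cont.comp ((continuous_circle_mul r).prodMk continuous_const)
    exact (this.mul continuous_const).mul continuous_const

/-- Separates the coefficients `a`, which will be Taylor coefficients of the function dilated, from
the pairings of `q`, which will not depend on that function. -/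
theorem CircleFamily.fourierCoeff_pairing {r : ℝ} (hr : 0 ≤ r) {Ψ : ℂ → ℂ → ℂ}
    (hΨ : CircleFamily r Ψ) {a : ℕ → ℂ} {q : ℕ → ℂ → ℂ}
    (hsum : ∀ s z, HasSum (fun k => a k * q k z * s ^ k) (Ψ s z))
    {g : ℂ → ℂ} (hg : g ∈ FockSpace) (n : ℤ) :
    fourierCoeff (fun x : UnitAddCircle => pairing (Ψ (r * fourier 1 x)) g) n =
      if 0 ≤ n then r ^ n.toNat * a n.toNat * pairing (q n.toNat) g else 0 := by
  obtain ⟨b, hb, h⟩ := hΨ.exists_integrable_bound hg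
  have hgc := hg.1.continuous
  have hint : Integrable (Function.uncurry fun (x : UnitAddCircle) (z : ℂ) =>
      Ψ (r * fourier 1 x) z * conj (g z) * ((Real.exp (-‖z‖ ^ 2) : ℝ) : ℂ))
      (haarAddCircle.prod volume) := by
    refine integrable_uncurry_of_dominated ?_ hb fun x z => h _ z (norm_circle_mul hr x)
    have h1 : Continuous fun p : UnitAddCircle × ℂ => Ψ (r * fourier 1 p.1) p.2 :=
      hΨ.cont.comp (((continuous_circle_mul r).comp continuous_fst).prodMk continuous_snd)
    exact (h1.mul (by fun_prop)).mul (by fun_prop)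
  have key := fourierCoeff_integral hint n
  refine key.trans ?_
  have hz : ∀ z, fourierCoeff (fun x : UnitAddCircle =>
      Ψ (r * fourier 1 x) z * conj (g z) * ((Real.exp (-‖z‖ ^ 2) : ℝ) : ℂ)) n =
      (if 0 ≤ n then (r : ℂ) ^ n.toNat * a n.toNat else 0) *
        (q n.toNat z * conj (g z) * ((Real.exp (-‖z‖ ^ 2) : ℝ) : ℂ)) := fun z => by
    have h1 := fourierCoeff_comp_circle
      (F := fun s => Ψ s z * (conj (g z) * ((Real.exp (-‖z‖ ^ 2) : ℝ) : ℂ)))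
      (a := fun k => a k * q k z * (conj (g z) * ((Real.exp (-‖z‖ ^ 2) : ℝ) : ℂ)))
      (fun s => ((hsum s z).mul_right _).congr_fun fun k => by ring) r n
    simp only [← mul_assoc] at h1
    rw [h1]
    split_ifs
    · ring
    · ring
  simp only [hz]
  rw [integral_const_mul]
  split_ifs
  · rfl
  · rw [zero_mul]

/-! ### Weighted composition with a derivative -/

/-- The regular factor of `weightedDeriv`. -/
noncomputable def weightedCore (m : ℕ) (α : ℝ) (β : ℂ) (g : ℂ → ℂ) (z : ℂ) : ℂ :=
  Complex.exp (conj β * z) * iteratedDeriv m g (α * z + β)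

/-- The formal operator `g ↦ z ^ m * exp (conj β * z) * g^{(m)} (α * z + β)`. -/
noncomputable def weightedDeriv (m : ℕ) (α : ℝ) (β : ℂ) (g : ℂ → ℂ) (z : ℂ) : ℂ :=
  z ^ m * weightedCore m α β g z

section WeightedDeriv

variable {m : ℕ} {α : ℝ} {β : ℂ}

theorem differentiable_weightedCore {g : ℂ → ℂ} (hg : Differentiable ℂ g) :
    Differentiable ℂ (weightedCore m α β g) := by
  have h1 := (differentiable_iteratedDeriv hg m).comp
    (show Differentiable ℂ fun z : ℂ => (α : ℂ) * z + β by fun_prop)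
  exact (show Differentiable ℂ fun z : ℂ => Complex.exp (conj β * z) by fun_prop).mul h1

theorem differentiable_weightedDeriv {g : ℂ → ℂ} (hg : Differentiable ℂ g) :
    Differentiable ℂ (weightedDeriv m α β g) :=
  (show Differentiable ℂ fun z : ℂ => z ^ m by fun_prop).mul (differentiable_weightedCore hg)

/-- Outside the unit disc the factor z^m has modulus at least 1, so the growth bound for the full
function applies; inside, compactness suffices. -/
theorem exists_norm_weightedCore_le {v : ℂ → ℂ} (hv : v ∈ FockSpace)
    (hu : weightedDeriv m α β v ∈ FockSpace) :
    ∃ M : ℝ, 0 ≤ M ∧ ∀ y, ‖weightedCore m α β v y‖ ≤ M * Real.exp (‖y‖ ^ 2 / 2) := by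
  obtain ⟨M₁, h₁, hM₁⟩ := exists_norm_le hu
  obtain ⟨M₂, hM₂⟩ := (isCompact_closedBall (0 : ℂ) 1).exists_bound_of_continuousOn
    (differentiable_weightedCore (m := m) (α := α) (β := β) hv.1).continuous.continuousOn
  refine ⟨max M₁ M₂, le_max_of_le_left h₁, fun y => ?_⟩
  rcases le_total ‖y‖ 1 with hy | hy
  · have h3 := hM₂ y (by simpa using hy)
    have h4 : 0 ≤ M₂ := (norm_nonneg _).trans h3
    calc _ ≤ M₂ * 1 := by simpa using h3
      _ ≤ _ := by
        gcongr
        · exact le_max_right _ _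
        · exact Real.one_le_exp (by positivity)
  · calc _ ≤ ‖weightedDeriv m α β v y‖ := by
          rw [weightedDeriv, norm_mul, norm_pow]
          exact le_mul_of_one_le_left (norm_nonneg _) (one_le_pow₀ hy)
      _ ≤ M₁ * Real.exp (‖y‖ ^ 2 / 2) := hM₁ y
      _ ≤ _ := by
        gcongr
        exact le_max_left _ _

/-- The point y = sz - (1 - s)β/α solves αy + β = s(αz + β): it is the dilate of z about the fixed
centre -β/α. Changing the exponential from z to y costs only an exponential of linear growth. -/
theorem weightedDeriv_dilation (hα : α ≠ 0) {v : ℂ → ℂ} (hv : Differentiable ℂ v) (s z : ℂ) :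
    weightedDeriv m α β (fun z => v (s * z)) z =
      s ^ m * z ^ m * Complex.exp ((1 - s) * (conj β * (z + β / α))) *
        weightedCore m α β v (s * z - (1 - s) * (β / α)) := by
  have hα' : (α : ℂ) ≠ 0 := by exact_mod_cast hα
  have h1 := iteratedDeriv_comp_affine hv s 0 m
  simp only [add_zero] at h1
  have e1 : (α : ℂ) * (s * z - (1 - s) * (β / α)) + β = s * (α * z + β) := by
    field_simp
    ring
  have e2 : Complex.exp (conj β * z) = Complex.exp ((1 - s) * (conj β * (z + β / α))) *
      Complex.exp (conj β * (s * z - (1 - s) * (β / α))) := by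
    rw [← Complex.exp_add]
    congr 1
    ring
  rw [weightedDeriv, weightedCore, weightedCore, h1, e1, e2]
  ring

theorem norm_one_sub_le {r : ℝ} (hr : r ≤ 1) {s : ℂ} (hs : ‖s‖ = r) : ‖1 - s‖ ≤ 2 := by
  have := norm_sub_le 1 s
  rw [norm_one] at this
  linarith

theorem circleFamily_dilation {r : ℝ} (hr1 : r < 1) {v : ℂ → ℂ} (hv : v ∈ FockSpace) (hr : 0 ≤ r) :
    CircleFamily r fun s z => v (s * z) := by
  have hc := hv.1.continuous
  obtain ⟨M, hM0, hM⟩ := exists_norm_le hv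
  refine ⟨by fun_prop, M, 0, r ^ 2 / 2, by nlinarith, fun s z hs => (hM _).trans_eq ?_⟩
  rw [norm_mul, hs]
  congr 2
  ring

theorem circleFamily_weightedDeriv (hα : α ≠ 0) {r : ℝ} (hr : 0 ≤ r) (hr1 : r < 1) {v : ℂ → ℂ}
    (hv : v ∈ FockSpace) (hu : weightedDeriv m α β v ∈ FockSpace) :
    CircleFamily r fun s => weightedDeriv m α β fun z => v (s * z) := by
  constructor
  · have h2 := (differentiable_iteratedDeriv hv.1 m).continuous
    have h3 : (Function.uncurry fun s => weightedDeriv m α β fun z => v (s * z)) =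
        fun p : ℂ × ℂ => p.2 ^ m * (Complex.exp (conj β * p.2) *
          (p.1 ^ m * iteratedDeriv m v (p.1 * (α * p.2 + β)))) := by
      ext ⟨s, z⟩
      have h1 := iteratedDeriv_comp_affine hv.1 s 0 m
      simp only [add_zero] at h1
      simp only [Function.uncurry_apply_pair, weightedDeriv, weightedCore, h1]
    rw [h3]
    fun_prop
  · obtain ⟨M, hM0, hM⟩ := exists_norm_weightedCore_le hv hu
    -- The core is evaluated at distance at most r|z| + 2|γ|, which gives the Gaussian rate r²/2 <
    -- 1/2; cross terms and the factor |z|^m go into the linear exponent.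
    set γ := β / α with hγ
    refine ⟨m.factorial * Real.exp (2 * ‖β‖ * ‖γ‖) * (M * Real.exp (2 * ‖γ‖ ^ 2)),
      1 + 2 * ‖β‖ + 2 * ‖γ‖, r ^ 2 / 2, by nlinarith, fun s z hs => ?_⟩
    have hs1 := norm_one_sub_le hr1.le hs
    rw [weightedDeriv_dilation hα hv.1, norm_mul, norm_mul, norm_mul, norm_pow, norm_pow, hs]
    have b1 : r ^ m * ‖z‖ ^ m ≤ 1 * (m.factorial * Real.exp ‖z‖) := by
      gcongr
      · exact pow_le_one₀ hr hr1.le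
      · exact pow_le_factorial_mul_exp m (norm_nonneg z)
    have b2 : ‖Complex.exp ((1 - s) * (conj β * (z + γ)))‖ ≤
        Real.exp (2 * (‖β‖ * (‖z‖ + ‖γ‖))) := by
      rw [Complex.norm_exp]
      refine Real.exp_le_exp.2 ((Complex.re_le_norm _).trans ?_)
      rw [norm_mul, norm_mul, RCLike.norm_conj]
      gcongr
      exact norm_add_le _ _
    have b3 : ‖weightedCore m α β v (s * z - (1 - s) * γ)‖ ≤
        M * Real.exp ((r * ‖z‖ + 2 * ‖γ‖) ^ 2 / 2) := by
      refine (hM _).trans ?_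
      gcongr
      refine (norm_sub_le _ _).trans ?_
      rw [norm_mul, norm_mul, hs]
      gcongr
    calc _ ≤ 1 * (m.factorial * Real.exp ‖z‖) * Real.exp (2 * (‖β‖ * (‖z‖ + ‖γ‖))) *
          (M * Real.exp ((r * ‖z‖ + 2 * ‖γ‖) ^ 2 / 2)) := by gcongr
      _ = m.factorial * M * Real.exp (‖z‖ + 2 * (‖β‖ * (‖z‖ + ‖γ‖)) +
          (r * ‖z‖ + 2 * ‖γ‖) ^ 2 / 2) := by
        rw [Real.exp_add, Real.exp_add]
        ring
      _ ≤ m.factorial * M * Real.exp (2 * ‖β‖ * ‖γ‖ + 2 * ‖γ‖ ^ 2 +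
          ((1 + 2 * ‖β‖ + 2 * ‖γ‖) * ‖z‖ + r ^ 2 / 2 * ‖z‖ ^ 2)) := by
        refine mul_le_mul_of_nonneg_left (Real.exp_le_exp.2 ?_) (by positivity)
        have : r * (‖γ‖ * ‖z‖) ≤ 1 * (‖γ‖ * ‖z‖) := by gcongr
        linarith
      _ = _ := by
        rw [Real.exp_add, Real.exp_add]
        ring

theorem CircleFamily.mem {r : ℝ} {Ψ : ℂ → ℂ → ℂ} (hΨ : CircleFamily r Ψ) {s : ℂ} (hs : ‖s‖ = r)
    (h : Differentiable ℂ (Ψ s)) : Ψ s ∈ FockSpace := by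
  obtain ⟨M, K, ε, hε, hb⟩ := hΨ.bound
  exact mem_of_norm_le h hε fun z => hb s z hs

theorem hasSum_dilation {v : ℂ → ℂ} (hv : Differentiable ℂ v) (s z : ℂ) :
    HasSum (fun k => iteratedDeriv k v 0 * (z ^ k / (k.factorial : ℂ)) * s ^ k) (v (s * z)) :=
  (hasSum_taylor hv (s * z)).congr_fun fun k => by ring

theorem hasSum_pow_mul_iteratedDeriv {v : ℂ → ℂ} (hv : Differentiable ℂ v) (s w : ℂ) :
    HasSum (fun k => iteratedDeriv k v 0 *
      (if m ≤ k then w ^ (k - m) / ((k - m).factorial : ℂ) else 0) * s ^ k)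
      (s ^ m * iteratedDeriv m v (s * w)) := by
  have h1 := (hasSum_taylor (differentiable_iteratedDeriv hv m) (s * w)).mul_left (s ^ m)
  -- Differentiating m times removes the terms of index below m, and the factor s^m restores the
  -- original powers of s.
  have hinj : Function.Injective fun k : ℕ => k + m := add_left_injective m
  refine (hinj.hasSum_iff fun k hk => ?_).1 (h1.congr_fun fun k => ?_)
  · have : ¬ m ≤ k := fun h => hk ⟨k - m, Nat.sub_add_cancel h⟩
    simp [this]
  · simp only [Function.comp, Nat.le_add_left, if_true, Nat.add_sub_cancel,
      iteratedDeriv_iteratedDeriv]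
    ring

theorem hasSum_weightedDeriv_dilation {v : ℂ → ℂ} (hv : Differentiable ℂ v) (s z : ℂ) :
    HasSum (fun k => iteratedDeriv k v 0 * (z ^ m * Complex.exp (conj β * z) *
      (if m ≤ k then ((α : ℂ) * z + β) ^ (k - m) / ((k - m).factorial : ℂ) else 0)) * s ^ k)
      (weightedDeriv m α β (fun z => v (s * z)) z) := by
  have h1 := (hasSum_pow_mul_iteratedDeriv (m := m) hv s (α * z + β)).mul_left
    (z ^ m * Complex.exp (conj β * z))
  have h2 := iteratedDeriv_comp_affine hv s 0 m
  simp only [add_zero] at h2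
  have h3 : weightedDeriv m α β (fun z => v (s * z)) z = z ^ m * Complex.exp (conj β * z) *
      (s ^ m * iteratedDeriv m v (s * (α * z + β))) := by
    simp only [weightedDeriv, weightedCore, h2]
    ring
  rw [h3]
  exact h1.congr_fun fun k => by ring

/-- The symmetry of `weightedDeriv` on exponentials. -/
theorem pairing_exp_weightedDeriv {g : ℂ → ℂ} (hg : g ∈ FockSpace)
    (hf : weightedDeriv m α β g ∈ FockSpace) (s : ℂ) :
    pairing (fun z => Complex.exp (s * z)) (weightedDeriv m α β g) =
      pairing (weightedDeriv m α β fun z => Complex.exp (s * z)) g := by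
  have h1 := pairing_kernel hf 0 (conj s)
  simp only [pow_zero, one_mul, Complex.conj_conj, iteratedDeriv_zero] at h1
  have h2 := pairing_kernel hg m (α * conj s + β)
  have h3 : weightedDeriv m α β (fun z => Complex.exp (s * z)) = fun z =>
      (s ^ m * Complex.exp (s * β)) *
        (z ^ m * Complex.exp (conj ((α : ℂ) * conj s + β) * z)) := by
    ext z
    have e : Complex.exp (conj β * z) * Complex.exp (s * (α * z + β)) =
        Complex.exp (s * β) * Complex.exp (conj ((α : ℂ) * conj s + β) * z) := by
      rw [← Complex.exp_add, ← Complex.exp_add]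
      congr 1
      simp only [map_add, map_mul, Complex.conj_conj, Complex.conj_ofReal]
      ring
    simp only [weightedDeriv, weightedCore, iteratedDeriv_cexp_const_mul]
    linear_combination z ^ m * s ^ m * e
  have h4 : pairing (weightedDeriv m α β fun z => Complex.exp (s * z)) g =
      (s ^ m * Complex.exp (s * β)) *
        pairing (fun z => z ^ m * Complex.exp (conj ((α : ℂ) * conj s + β) * z)) g := by
    rw [h3]
    unfold pairing
    rw [← integral_const_mul]
    congr 1
    ext z
    ring
  rw [h4, ← pairing_conj_symm, h1, ← pairing_conj_symm g, h2]
  simp only [weightedDeriv, weightedCore, map_mul, map_pow, Complex.conj_conj, Complex.conj_ofReal,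
    ← Complex.exp_conj]
  ring_nf

theorem exp_mem : Complex.exp ∈ FockSpace := by
  simpa using pow_mul_exp_mem 0 1

theorem weightedDeriv_exp_mem : weightedDeriv m α β Complex.exp ∈ FockSpace := by
  have h := FockSpace.smul_mem (Complex.exp β) (pow_mul_exp_mem m (conj β + α))
  convert h using 1
  ext z
  have := iteratedDeriv_cexp_const_mul m 1
  simp only [one_mul, one_pow] at this
  simp only [weightedDeriv, weightedCore, Pi.smul_apply, smul_eq_mul, this, add_mul,
    Complex.exp_add]
  ring

theorem fourierCoeff_sub {F G : UnitAddCircle → ℂ} (hF : Integrable F haarAddCircle)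
    (hG : Integrable G haarAddCircle) (n : ℤ) :
    fourierCoeff (fun x => F x - G x) n = fourierCoeff F n - fourierCoeff G n := by
  simp only [fourierCoeff, smul_sub]
  exact integral_sub (hF.fourier_smul (-n)) (hG.fourier_smul (-n))

/-- Each Fourier coefficient of the defect of symmetry is a Taylor derivative of the dilated
function times a defect independent of that function. For the exponential all these derivatives
equal 1 and the total defect is 0, so every such factor vanishes. -/
theorem pairing_dilation_weightedDeriv (hα : α ≠ 0) {g v : ℂ → ℂ} (hg : g ∈ FockSpace)
    (hf : weightedDeriv m α β g ∈ FockSpace) (hv : v ∈ FockSpace)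
    (hu : weightedDeriv m α β v ∈ FockSpace) {r : ℝ} (hr : 0 < r) (hr1 : r < 1) :
    pairing (fun z => v (r * z)) (weightedDeriv m α β g) =
      pairing (weightedDeriv m α β fun z => v (r * z)) g := by
  set p : ℕ → ℂ → ℂ := fun k z => z ^ k / (k.factorial : ℂ) with hp
  set q : ℕ → ℂ → ℂ := fun k z => z ^ m * Complex.exp (conj β * z) *
      (if m ≤ k then ((α : ℂ) * z + β) ^ (k - m) / ((k - m).factorial : ℂ) else 0) with hq
  have coeff : ∀ w ∈ FockSpace, weightedDeriv m α β w ∈ FockSpace → ∀ n : ℤ,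
      fourierCoeff (fun x : UnitAddCircle =>
        pairing (fun z => w (r * fourier 1 x * z)) (weightedDeriv m α β g) -
        pairing (weightedDeriv m α β fun z => w (r * fourier 1 x * z)) g) n =
      if 0 ≤ n then r ^ n.toNat * iteratedDeriv n.toNat w 0 *
        (pairing (p n.toNat) (weightedDeriv m α β g) - pairing (q n.toNat) g) else 0 := by
    intro w hw hLw n
    have c1 := circleFamily_dilation hr1 hw hr.le
    have c2 := circleFamily_weightedDeriv hα hr.le hr1 hw hLw
    have k1 := c1.fourierCoeff_pairing (q := p) hr.le (hasSum_dilation hw.1) hf n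
    have k2 := c2.fourierCoeff_pairing (q := q) hr.le (hasSum_weightedDeriv_dilation hw.1) hg n
    have i1 := (c1.continuous_pairing hr.le hf).integrable_of_hasCompactSupport
      (μ := haarAddCircle) (HasCompactSupport.of_compactSpace _)
    have i2 := (c2.continuous_pairing hr.le hg).integrable_of_hasCompactSupport
      (μ := haarAddCircle) (HasCompactSupport.of_compactSpace _)
    rw [fourierCoeff_sub i1 i2, k1, k2]
    split_ifs
    · ring
    · exact sub_zero 0
  have hE : ∀ n : ℕ, pairing (p n) (weightedDeriv m α β g) - pairing (q n) g = 0 := by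
    intro n
    have h1 := coeff Complex.exp exp_mem weightedDeriv_exp_mem n
    have h2 : iteratedDeriv n Complex.exp 0 = 1 := by
      have := iteratedDeriv_cexp_const_mul n 1
      simp only [one_mul, one_pow] at this
      simp [this]
    simp only [pairing_exp_weightedDeriv hg hf, sub_self, Int.natCast_nonneg, if_true,
      Int.toNat_natCast, h2, mul_one] at h1
    have h3 : (r : ℂ) ^ n ≠ 0 := pow_ne_zero _ (by exact_mod_cast hr.ne')
    have h4 : fourierCoeff (fun _ : UnitAddCircle => (0 : ℂ)) n = 0 := by simp [fourierCoeff]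
    rw [h4] at h1
    exact (mul_eq_zero.1 h1.symm).resolve_left h3
  -- The defect vanishes on the whole circle; the angle 0 gives s = r.
  have h1 := eq_zero_of_fourierCoeff_eq_zero
    (F := fun x => pairing (fun z => v (r * fourier 1 x * z)) (weightedDeriv m α β g) -
        pairing (weightedDeriv m α β fun z => v (r * fourier 1 x * z)) g)
    (((circleFamily_dilation hr1 hv hr.le).continuous_pairing hr.le hf).sub
      ((circleFamily_weightedDeriv hα hr.le hr1 hv hu).continuous_pairing hr.le hg))
    (fun n => (coeff v hv hu n).trans (by simp [hE])) 0
  have h2 : (r : ℂ) * fourier 1 (0 : UnitAddCircle) = r := by rw [fourier_eval_zero, mul_one]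
  rw [h2] at h1
  exact sub_eq_zero.1 h1

/-! ### Weak limits -/

/-- With D = H_n - h, split |D||g| into δ|D|², controlled by the norm bound, and the positive part
of |D||g| - δ|D|², dominated by |g|²/(4δ) and hence tending to 0 in integral. -/
theorem tendsto_pairing_of_bounded {H : ℕ → ℂ → ℂ} {h g : ℂ → ℂ} (hH : ∀ n, H n ∈ FockSpace)
    (hh : h ∈ FockSpace) (hg : g ∈ FockSpace) (hlim : ∀ z, Tendsto (fun n => H n z) atTop (𝓝 (h z)))
    {K : ℝ} (hK : ∀ n, ∫ z, ‖H n z‖ ^ 2 * Real.exp (-‖z‖ ^ 2) ≤ K) :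
    Tendsto (fun n => pairing (H n) g) atTop (𝓝 (pairing h g)) := by
  set N := ∫ z, ‖h z‖ ^ 2 * Real.exp (-‖z‖ ^ 2) with hN
  have hN0 : 0 ≤ N := integral_nonneg fun z => by positivity
  have hK0 : 0 ≤ K := (integral_nonneg fun z => by positivity).trans (hK 0)
  have hD : ∀ n, H n - h ∈ FockSpace := fun n => FockSpace.sub_mem (hH n) hh
  have hDK : ∀ n, ∫ z, ‖(H n - h) z‖ ^ 2 * Real.exp (-‖z‖ ^ 2) ≤ 2 * (K + N) := fun n => by
    calc _ ≤ ∫ z, 2 * (‖H n z‖ ^ 2 * Real.exp (-‖z‖ ^ 2) + ‖h z‖ ^ 2 * Real.exp (-‖z‖ ^ 2)) := by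
          refine integral_mono (hD n).2 (((hH n).2.add hh.2).const_mul 2) fun z => ?_
          simp only [Pi.sub_apply]
          rw [← add_mul, ← mul_assoc]
          gcongr
          have := norm_sub_le (H n z) (h z)
          nlinarith [norm_nonneg (H n z - h z), sq_nonneg (‖H n z‖ - ‖h z‖)]
      _ = 2 * ((∫ z, ‖H n z‖ ^ 2 * Real.exp (-‖z‖ ^ 2)) + N) := by
          rw [integral_const_mul, integral_add (hH n).2 hh.2]
      _ ≤ _ := by gcongr; exact hK n
  rw [Metric.tendsto_atTop]
  intro ε hε
  -- The squared norm of D is at most 2(K + N); the added 1 keeps the denominator positive.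
  set δ := ε / (2 * (2 * (K + N) + 1)) with hδ
  have hδ0 : 0 < δ := by positivity
  have hδK : δ * (2 * (K + N)) < ε / 2 := by
    have : ε / 2 = δ * (2 * (K + N) + 1) := by
      rw [hδ]
      field_simp
    rw [this]
    nlinarith
  set F : ℕ → ℂ → ℝ := fun n z =>
    max 0 (‖(H n - h) z‖ * ‖g z‖ - δ * ‖(H n - h) z‖ ^ 2) * Real.exp (-‖z‖ ^ 2) with hF
  have hFb : ∀ n z, ‖F n z‖ ≤ (4 * δ)⁻¹ * (‖g z‖ ^ 2 * Real.exp (-‖z‖ ^ 2)) := fun n z => by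
    rw [Real.norm_of_nonneg (mul_nonneg (le_max_left _ _) (Real.exp_nonneg _)), ← mul_assoc]
    gcongr
    refine max_le (by positivity) ?_
    have h1 : 0 ≤ (4 * δ)⁻¹ * (‖g z‖ - 2 * δ * ‖(H n - h) z‖) ^ 2 := by positivity
    have h2 : (4 * δ)⁻¹ * (‖g z‖ - 2 * δ * ‖(H n - h) z‖) ^ 2 =
        (4 * δ)⁻¹ * ‖g z‖ ^ 2 - (‖(H n - h) z‖ * ‖g z‖ - δ * ‖(H n - h) z‖ ^ 2) := by
      field_simp
      ring
    linarith
  have hFm : ∀ n, AEStronglyMeasurable (F n) volume := fun n => by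
    have h1 := (hD n).1.continuous
    have h2 := hg.1.continuous
    exact Continuous.aestronglyMeasurable (by fun_prop)
  have hFi : ∀ n, Integrable (F n) := fun n =>
    (hg.2.const_mul _).mono' (hFm n) (Eventually.of_forall (hFb n))
  have hF0 : Tendsto (fun n => ∫ z, F n z) atTop (𝓝 0) := by
    rw [← integral_zero ℂ ℝ (μ := volume)]
    refine tendsto_integral_of_dominated_convergence _ hFm (hg.2.const_mul _)
      (fun n => Eventually.of_forall (hFb n)) (Eventually.of_forall fun z => ?_)
    have h1 : Tendsto (fun n => ‖(H n - h) z‖) atTop (𝓝 0) := by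
      have := ((hlim z).sub_const (h z)).norm
      rwa [sub_self, norm_zero] at this
    have h2 := ((tendsto_const_nhds (x := (0 : ℝ))).max
      ((h1.mul_const ‖g z‖).sub ((h1.pow 2).const_mul δ))).mul_const (Real.exp (-‖z‖ ^ 2))
    simpa [hF] using h2
  obtain ⟨n₀, hn₀⟩ := (hF0.eventually_lt_const (half_pos hε)).exists_forall_of_atTop
  refine ⟨n₀, fun n hn => ?_⟩
  have e : pairing (H n) g - pairing h g = pairing (H n - h) g := by
    unfold pairing
    rw [← integral_sub (integrable_mul_conj (hH n) hg) (integrable_mul_conj hh hg)]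
    congr 1
    ext z
    simp only [Pi.sub_apply]
    ring
  rw [dist_eq_norm, e]
  calc ‖pairing (H n - h) g‖
      ≤ ∫ z, (F n z + δ * (‖(H n - h) z‖ ^ 2 * Real.exp (-‖z‖ ^ 2))) := by
        refine norm_integral_le_of_norm_le ((hFi n).add ((hD n).2.const_mul δ))
          (Eventually.of_forall fun z => ?_)
        rw [norm_mul, norm_mul, RCLike.norm_conj, Complex.norm_real,
          Real.norm_of_nonneg (Real.exp_nonneg _), ← mul_assoc, ← add_mul]
        gcongr
        linarith [le_max_right 0 (‖(H n - h) z‖ * ‖g z‖ - δ * ‖(H n - h) z‖ ^ 2)]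
    _ = (∫ z, F n z) + δ * ∫ z, ‖(H n - h) z‖ ^ 2 * Real.exp (-‖z‖ ^ 2) := by
        rw [integral_add (hFi n) ((hD n).2.const_mul δ), integral_const_mul]
    _ < ε / 2 + ε / 2 := by
        refine add_lt_add (hn₀ n hn) (lt_of_le_of_lt ?_ hδK)
        gcongr
        exact hDK n
    _ = ε := add_halves ε

theorem integral_comp_mul_sub (F : ℂ → ℝ) (r : ℝ) (c : ℂ) :
    ∫ z : ℂ, F (r * z - c) = (r ^ 2)⁻¹ * ∫ z, F z := by
  have h1 := Measure.integral_comp_smul (volume : Measure ℂ) (fun z => F (z - c)) r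
  rw [integral_sub_right_eq_self, Complex.finrank_real_complex] at h1
  simpa [abs_of_nonneg, sq_nonneg] using h1

theorem integrable_comp_mul_sub {F : ℂ → ℝ} (hF : Integrable F) {r : ℝ} (hr : r ≠ 0) (c : ℂ) :
    Integrable fun z : ℂ => F (r * z - c) := by
  simpa using (hF.comp_sub_right c).comp_smul hr

theorem inv_sq_le_four {r : ℝ} (hr : 1 / 2 ≤ r) : (r ^ 2)⁻¹ ≤ 4 := by
  rw [inv_le_comm₀ (by positivity) (by norm_num)]
  nlinarith

theorem integral_norm_sq_dilation_le {v : ℂ → ℂ} (hv : v ∈ FockSpace) {r : ℝ} (hr : 1 / 2 ≤ r)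
    (hr1 : r < 1) : ∫ z : ℂ, ‖v (r * z)‖ ^ 2 * Real.exp (-‖z‖ ^ 2) ≤
      4 * ∫ z, ‖v z‖ ^ 2 * Real.exp (-‖z‖ ^ 2) := by
  have h0 : 0 ≤ ∫ z, ‖v z‖ ^ 2 * Real.exp (-‖z‖ ^ 2) := integral_nonneg fun z => by positivity
  have hc := hv.1.continuous
  have hi := integrable_comp_mul_sub hv.2 (show r ≠ 0 by linarith) 0
  have hle : ∀ z : ℂ, ‖v (r * z)‖ ^ 2 * Real.exp (-‖z‖ ^ 2) ≤
      ‖v (r * z - 0)‖ ^ 2 * Real.exp (-‖r * z - 0‖ ^ 2) := fun z => by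
    rw [sub_zero]
    gcongr
    rw [norm_mul, Complex.norm_real, Real.norm_of_nonneg (by linarith)]
    exact mul_le_of_le_one_left (norm_nonneg z) hr1.le
  calc _ ≤ ∫ z : ℂ, ‖v (r * z - 0)‖ ^ 2 * Real.exp (-‖r * z - 0‖ ^ 2) := by
        refine integral_mono (hi.mono' (Continuous.aestronglyMeasurable (by fun_prop))
          (Eventually.of_forall fun z => ?_)) hi hle
        rw [Real.norm_of_nonneg (by positivity)]
        exact hle z
    _ = (r ^ 2)⁻¹ * ∫ z, ‖v z‖ ^ 2 * Real.exp (-‖z‖ ^ 2) :=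
        integral_comp_mul_sub (fun z => ‖v z‖ ^ 2 * Real.exp (-‖z‖ ^ 2)) r 0
    _ ≤ _ := by
        gcongr
        exact inv_sq_le_four hr

/-- With y = rz - (1 - r)γ, the exponential factor has exponent of order (1 - r)|z|, while |z|² -
|y|² gains about (1 - r)|z|². The Gaussian thus absorbs it uniformly in r, leaving an integrable
majorant in y; the change of variables costs r⁻² ≤ 4. -/
theorem exists_integral_norm_sq_weightedDeriv_le (hα : α ≠ 0) {v : ℂ → ℂ} (hv : v ∈ FockSpace)
    (hu : weightedDeriv m α β v ∈ FockSpace) : ∃ K : ℝ, ∀ r : ℝ, 1 / 2 ≤ r → r < 1 →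
      ∫ z : ℂ, ‖weightedDeriv m α β (fun z => v (r * z)) z‖ ^ 2 * Real.exp (-‖z‖ ^ 2) ≤ K := by
  obtain ⟨M, hM0, hM⟩ := exists_norm_weightedCore_le hv hu
  set γ := β / α with hγ
  -- For r ≥ 1/2 one has |z| ≤ 2(|y| + |γ|), so |z|^m is at most c when |y| ≤ 1 and at most c|y|^m
  -- when |y| ≥ 1.
  set c := (2 * (1 + ‖γ‖)) ^ m with hc
  set M₂ := M * Real.exp (1 / 2) with hM₂
  -- The first term of the exponent comes from completing the square in |z|, the others from the
  -- constant parts of the exponential and of |y|².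
  set E := Real.exp ((‖β‖ + ‖γ‖) ^ 2 + 2 * (‖β‖ * ‖γ‖) + ‖γ‖ ^ 2) with hE
  set u := weightedDeriv m α β v with hu'
  set Q : ℂ → ℝ := fun y => c ^ 2 * E * (‖u y‖ ^ 2 * Real.exp (-‖y‖ ^ 2) +
    M₂ ^ 2 * Real.exp (-1 * ‖y‖ ^ 2)) with hQ
  have hQi : Integrable Q :=
    (hu.2.add ((integrable_exp_neg_mul_norm_sq one_pos).const_mul _)).const_mul _
  have hQ0 : 0 ≤ ∫ y, Q y := integral_nonneg fun y => by positivity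
  refine ⟨4 * ∫ y, Q y, fun r hr hr1 => ?_⟩
  have hle : ∀ z : ℂ, ‖weightedDeriv m α β (fun z => v (r * z)) z‖ ^ 2 * Real.exp (-‖z‖ ^ 2) ≤
      Q (r * z - (1 - r) * γ) := fun z => by
    set y := r * z - (1 - r) * γ with hy
    have hnr : ‖(1 - r : ℂ)‖ = 1 - r := by
      rw [← Complex.ofReal_one, ← Complex.ofReal_sub, Complex.norm_real,
        Real.norm_of_nonneg (by linarith)]
    have hnr' : ‖(r : ℂ)‖ = r := by rw [Complex.norm_real, Real.norm_of_nonneg (by linarith)]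
    have hzy : ‖z‖ ≤ 2 * (‖y‖ + ‖γ‖) := by
      have h1 : (r : ℂ) * z = y + (1 - r) * γ := by rw [hy]; ring
      have h2 := norm_add_le y ((1 - r) * γ)
      rw [← h1, norm_mul, norm_mul, hnr, hnr'] at h2
      nlinarith [norm_nonneg z, norm_nonneg γ, mul_nonneg (sub_nonneg.2 hr) (norm_nonneg z),
        mul_nonneg (show 0 ≤ r by linarith) (norm_nonneg γ)]
    have hyz : ‖y‖ ≤ r * ‖z‖ + (1 - r) * ‖γ‖ := by
      have h2 := norm_sub_le (r * z) ((1 - r) * γ)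
      rwa [norm_mul, norm_mul, hnr, hnr'] at h2
    have hcore : (‖z‖ ^ m * ‖weightedCore m α β v y‖) ^ 2 ≤ c ^ 2 * (‖u y‖ ^ 2 + M₂ ^ 2) := by
      rcases le_total ‖y‖ 1 with h | h
      · have h1 : ‖z‖ ^ m ≤ c := pow_le_pow_left₀ (norm_nonneg z) (by linarith) m
        have h2 : ‖weightedCore m α β v y‖ ≤ M₂ := by
          refine (hM y).trans (mul_le_mul_of_nonneg_left (Real.exp_le_exp.2 ?_) hM0)
          have := pow_le_one₀ (n := 2) (norm_nonneg y) h
          linarith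
        calc _ ≤ (c * M₂) ^ 2 := by gcongr
          _ ≤ _ := by
            rw [mul_pow]
            gcongr
            exact le_add_of_nonneg_left (by positivity)
      · have h1 : ‖z‖ ^ m ≤ c * ‖y‖ ^ m := by
          rw [hc, ← mul_pow]
          gcongr
          nlinarith [norm_nonneg γ, mul_nonneg (norm_nonneg γ) (sub_nonneg.2 h)]
        have h2 : ‖u y‖ = ‖y‖ ^ m * ‖weightedCore m α β v y‖ := by
          rw [hu', weightedDeriv, norm_mul, norm_pow]
        calc _ ≤ (c * ‖y‖ ^ m * ‖weightedCore m α β v y‖) ^ 2 := by gcongr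
          _ = c ^ 2 * ‖u y‖ ^ 2 := by
            rw [h2]
            ring
          _ ≤ _ := by
            gcongr
            exact le_add_of_nonneg_right (by positivity)
    have hexp : ‖Complex.exp ((1 - r) * (conj β * (z + γ)))‖ ≤
        Real.exp ((1 - r) * (‖β‖ * (‖z‖ + ‖γ‖))) := by
      rw [Complex.norm_exp]
      refine Real.exp_le_exp.2 ((Complex.re_le_norm _).trans ?_)
      rw [norm_mul, norm_mul, RCLike.norm_conj, hnr]
      have := norm_add_le z γ
      gcongr
    have hL : ‖weightedDeriv m α β (fun z => v (r * z)) z‖ ≤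
        Real.exp ((1 - r) * (‖β‖ * (‖z‖ + ‖γ‖))) * (‖z‖ ^ m * ‖weightedCore m α β v y‖) := by
      rw [weightedDeriv_dilation hα hv.1, norm_mul, norm_mul, norm_mul, norm_pow, norm_pow, hnr']
      have hrm : r ^ m ≤ 1 := pow_le_one₀ (by linarith) hr1.le
      calc _ ≤ 1 * ‖z‖ ^ m * Real.exp ((1 - r) * (‖β‖ * (‖z‖ + ‖γ‖))) *
            ‖weightedCore m α β v y‖ := by gcongr
        _ = _ := by ring
    have hfin : Real.exp (2 * ((1 - r) * (‖β‖ * (‖z‖ + ‖γ‖))) - ‖z‖ ^ 2) ≤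
        E * Real.exp (-‖y‖ ^ 2) := by
      rw [hE, ← Real.exp_add]
      refine Real.exp_le_exp.2 ?_
      have h1 : ‖y‖ ^ 2 ≤ (r * ‖z‖ + (1 - r) * ‖γ‖) ^ 2 := by gcongr
      have ht : 0 ≤ 1 - r := by linarith
      have hb := norm_nonneg β
      have hg := norm_nonneg γ
      have hz := norm_nonneg z
      have h2 : 0 ≤ (1 - r) * (‖z‖ - (‖β‖ + ‖γ‖)) ^ 2 := by positivity
      have h3 : 0 ≤ r * (‖β‖ + ‖γ‖) ^ 2 := mul_nonneg (by linarith) (sq_nonneg _)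
      have h4 : 0 ≤ r * (1 - r) * ‖z‖ ^ 2 := by
        have : 0 ≤ r := by linarith
        positivity
      have h5 : 0 ≤ (1 - r) ^ 2 * (‖γ‖ * ‖z‖) := by positivity
      have h6 : 0 ≤ r * (‖β‖ * ‖γ‖) := mul_nonneg (by linarith) (by positivity)
      have h7 : (1 - r) ^ 2 * ‖γ‖ ^ 2 ≤ 1 * ‖γ‖ ^ 2 := by
        gcongr
        nlinarith
      nlinarith
    calc _ ≤ (Real.exp ((1 - r) * (‖β‖ * (‖z‖ + ‖γ‖))) *
          (‖z‖ ^ m * ‖weightedCore m α β v y‖)) ^ 2 * Real.exp (-‖z‖ ^ 2) := by gcongr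
      _ = (‖z‖ ^ m * ‖weightedCore m α β v y‖) ^ 2 *
          Real.exp (2 * ((1 - r) * (‖β‖ * (‖z‖ + ‖γ‖))) - ‖z‖ ^ 2) := by
        rw [mul_pow, ← Real.exp_nat_mul, sub_eq_add_neg _ (‖z‖ ^ 2), Real.exp_add]
        push_cast
        ring
      _ ≤ c ^ 2 * (‖u y‖ ^ 2 + M₂ ^ 2) * (E * Real.exp (-‖y‖ ^ 2)) := by gcongr
      _ = Q y := by
        simp only [hQ, neg_one_mul]
        ring
  have hi := integrable_comp_mul_sub hQi (show r ≠ 0 by linarith) ((1 - r) * γ)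
  have hcont : Continuous (weightedDeriv m α β fun z => v (r * z)) :=
    (differentiable_weightedDeriv (hv.1.comp (by fun_prop))).continuous
  calc _ ≤ ∫ z : ℂ, Q (r * z - (1 - r) * γ) := by
        refine integral_mono (hi.mono' (Continuous.aestronglyMeasurable (by fun_prop))
          (Eventually.of_forall fun z => ?_)) hi hle
        rw [Real.norm_of_nonneg (by positivity)]
        exact hle z
    _ = (r ^ 2)⁻¹ * ∫ y, Q y := integral_comp_mul_sub Q r _
    _ ≤ _ := by
        gcongr
        exact inv_sq_le_four hr

/-- On its maximal domain, `weightedDeriv` is symmetric. -/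
theorem pairing_weightedDeriv (hα : α ≠ 0) {g v : ℂ → ℂ} (hg : g ∈ FockSpace)
    (hf : weightedDeriv m α β g ∈ FockSpace) (hv : v ∈ FockSpace)
    (hu : weightedDeriv m α β v ∈ FockSpace) :
    pairing v (weightedDeriv m α β g) = pairing (weightedDeriv m α β v) g := by
  -- A sequence in [1/2, 1) tending to 1, so that the bounds uniform in r apply.
  set r : ℕ → ℝ := fun n => 1 - 1 / ((n : ℝ) + 2) with hr
  have hr2 : ∀ n, 1 / 2 ≤ r n := fun n => by
    have : 1 / ((n : ℝ) + 2) ≤ 1 / 2 := by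
      gcongr
      linarith [(Nat.cast_nonneg n : (0 : ℝ) ≤ n)]
    simp only [hr]
    linarith
  have hr0 : ∀ n, 0 < r n := fun n => by linarith [hr2 n]
  have hr1 : ∀ n, r n < 1 := fun n => by
    have : 0 < 1 / ((n : ℝ) + 2) := by positivity
    simp only [hr]
    linarith
  have hlim : Tendsto (fun n => (r n : ℂ)) atTop (𝓝 1) := by
    have h1 : Tendsto (fun n : ℕ => 1 / ((n : ℝ) + 2)) atTop (𝓝 0) := by
      have := (tendsto_one_div_add_atTop_nhds_zero_nat (𝕜 := ℝ)).comp (tendsto_add_atTop_nat 1)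
      refine this.congr fun n => ?_
      simp only [Function.comp]
      push_cast
      ring_nf
    have h2 : Tendsto r atTop (𝓝 1) := by simpa [hr] using h1.const_sub 1
    exact_mod_cast (Complex.continuous_ofReal.tendsto 1).comp h2
  have hnorm : ∀ n, ‖(r n : ℂ)‖ = r n := fun n => by
    rw [Complex.norm_real, Real.norm_of_nonneg (hr0 n).le]
  obtain ⟨K, hK⟩ := exists_integral_norm_sq_weightedDeriv_le hα hv hu
  have hd : ∀ n, Differentiable ℂ fun z => v (r n * z) := fun n => hv.1.comp (by fun_prop)
  -- Taken at radius 0 only for its joint continuity, which does not involve the radius.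
  have c0 := circleFamily_weightedDeriv hα le_rfl one_pos hv hu
  have l1 := tendsto_pairing_of_bounded (H := fun n z => v (r n * z))
    (fun n => (circleFamily_dilation (hr1 n) hv (hr0 n).le).mem (hnorm n) (hd n)) hv hf
    (fun z => by
      have := (hv.1.continuous.tendsto (1 * z)).comp (hlim.mul_const z)
      rwa [one_mul] at this)
    (fun n => integral_norm_sq_dilation_le hv (hr2 n) (hr1 n))
  have l2 := tendsto_pairing_of_bounded (H := fun n => weightedDeriv m α β fun z => v (r n * z))
    (fun n => (circleFamily_weightedDeriv hα (hr0 n).le (hr1 n) hv hu).mem (hnorm n)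
      (differentiable_weightedDeriv (hd n))) hu hg
    (fun z => by
      have h1 : Continuous fun s => weightedDeriv m α β (fun z => v (s * z)) z :=
        c0.cont.comp (continuous_id.prodMk continuous_const)
      have := (h1.tendsto 1).comp hlim
      simp only [one_mul] at this
      exact this)
    (fun n => hK _ (hr2 n) (hr1 n))
  refine tendsto_nhds_unique (l1.congr fun n => ?_) l2
  exact pairing_dilation_weightedDeriv hα hg hf hv hu (hr0 n) (hr1 n)

end WeightedDeriv

/-! ### The functional equation of the symbols -/

theorem eq_zero_of_exp_eq_one {L : ℂ → ℂ} (hL : Differentiable ℂ L)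
    (h : ∀ z, Complex.exp (L z) = 1) (h0 : L 0 = 0) (z : ℂ) : L z = 0 := by
  have h1 : ∀ z, deriv L z = 0 := fun z => by
    have h2 := (hL z).hasDerivAt.cexp
    have h3 : (fun z => Complex.exp (L z)) = fun _ => 1 := funext h
    rw [h3, h z, one_mul] at h2
    exact h2.unique (hasDerivAt_const z 1)
  rw [is_const_of_deriv_eq_zero hL h1 z 0, h0]

theorem eq_zero_of_mul_eq_zero {f g : ℂ → ℂ} (hf : Differentiable ℂ f) (hg : Differentiable ℂ g)
    (hf0 : ∃ z, f z ≠ 0) (h : ∀ z, f z * g z = 0) (z : ℂ) : g z = 0 := by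
  obtain ⟨z₀, hz₀⟩ := hf0
  have h1 : ∀ᶠ z in 𝓝 z₀, g z = 0 :=
    (hf.continuous.continuousAt.eventually_ne hz₀).mono fun z hz =>
      (mul_eq_zero.1 (h z)).resolve_left hz
  have h2 : AnalyticOnNhd ℂ g Set.univ := fun z _ => hg.analyticAt z
  exact h2.eqOn_zero_of_preconnected_of_eventuallyEq_zero isPreconnected_univ (Set.mem_univ z₀) h1
    (Set.mem_univ z)

theorem differentiable_conj_conj {f : ℂ → ℂ} (hf : Differentiable ℂ f) :
    Differentiable ℂ fun z => conj (f (conj z)) := fun z => by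
  have := (hf (conj z)).conj_conj
  rwa [Complex.conj_conj] at this

/-- The exponential functional equation linking the symbols forces them into closed form. -/
theorem symbols_of_functional_equation {P φ χ : ℂ → ℂ} (hφ : Differentiable ℂ φ)
    (hχ : Differentiable ℂ χ) (hP0 : ∃ z, P z ≠ 0) (hχ0 : ∃ z, χ z ≠ 0)
    (h : ∀ z w, P z * conj (χ w) * Complex.exp (conj w * φ z) =
      χ z * conj (P w) * Complex.exp (conj (φ w) * z)) :
    ∃ (A C : ℝ) (B : ℂ), C ≠ 0 ∧ (∀ z, φ z = A * z + B) ∧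
      ∀ z, C * Complex.exp (z * conj B) * χ z = P z := by
  obtain ⟨w₀, hw₀⟩ := id hχ0
  have hcw₀ : conj (χ w₀) ≠ 0 := (map_ne_zero _).2 hw₀
  -- Freezing w = w₀ exhibits P as χ times a nowhere vanishing entire function R.
  set κ := conj (P w₀) / conj (χ w₀) with hκ
  set R : ℂ → ℂ := fun z => κ * Complex.exp (conj (φ w₀) * z - conj w₀ * φ z) with hR
  have hPR : ∀ z, P z = χ z * R z := fun z => by
    have h1 := h z w₀
    simp only [hR, hκ, Complex.exp_sub]
    have := Complex.exp_ne_zero (conj w₀ * φ z)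
    field_simp
    linear_combination h1
  have hκ0 : κ ≠ 0 := by
    intro h0
    obtain ⟨z, hz⟩ := hP0
    exact hz (by rw [hPR, hR]; simp [h0])
  have hRd : Differentiable ℂ R := by fun_prop
  have key : ∀ w z, R z * Complex.exp (conj w * φ z) =
      conj (R w) * Complex.exp (conj (φ w) * z) := by
    have k1 : ∀ w, χ w ≠ 0 → ∀ z, R z * Complex.exp (conj w * φ z) -
        conj (R w) * Complex.exp (conj (φ w) * z) = 0 := fun w hw => by
      have hcw : conj (χ w) ≠ 0 := (map_ne_zero _).2 hw
      refine eq_zero_of_mul_eq_zero hχ (by fun_prop) hχ0 fun z => ?_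
      have h1 := h z w
      rw [hPR z, hPR w, map_mul] at h1
      refine (mul_eq_zero.1 (?_ : conj (χ w) * _ = 0)).resolve_left hcw
      linear_combination h1
    intro w z
    -- The relation is antiholomorphic in w; after conjugation the identity theorem removes the
    -- restriction χ(w) ≠ 0.
    have k2 := eq_zero_of_mul_eq_zero (f := χ)
      (g := fun w => conj (R z) * Complex.exp (conj (φ z) * w) -
        R w * Complex.exp (conj z * φ w)) hχ (by fun_prop) hχ0 (fun w => ?_) w
    · have := congrArg conj k2
      simp only [map_sub, map_mul, ← Complex.exp_conj, Complex.conj_conj, map_zero] at this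
      rw [mul_comm (conj (φ w))]
      rw [mul_comm (φ z)] at this
      linear_combination this
    · by_cases hw : χ w = 0
      · rw [hw, zero_mul]
      · have := congrArg conj (k1 w hw z)
        simp only [map_sub, map_mul, ← Complex.exp_conj, Complex.conj_conj, map_zero] at this
        rw [mul_comm (conj (φ z)), mul_comm (conj z)]
        linear_combination χ w * this
  set B := φ 0 with hB
  have hR0 : conj (R 0) = R 0 := by
    have := key 0 0
    simpa using this.symm
  obtain ⟨C, hC⟩ := Complex.conj_eq_iff_real.1 hR0
  have hRz : ∀ z, R z = C * Complex.exp (z * conj B) := fun z => by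
    have := key 0 z
    simp only [map_zero, zero_mul, Complex.exp_zero, mul_one, hC, Complex.conj_ofReal, ← hB] at this
    rw [this, mul_comm z]
  have hC0 : (C : ℂ) ≠ 0 := by
    rw [← hC]
    exact mul_ne_zero hκ0 (Complex.exp_ne_zero _)
  -- Substituting the formula for R leaves an equality of exponentials. The difference of exponents
  -- is entire in z and vanishes at 0, so it is identically 0; w = 1 then makes φ affine, and z = w
  -- = 1 makes its slope real.
  have hL : ∀ w z, z * conj B + conj w * φ z - (conj w * B + conj (φ w) * z) = 0 := fun w => by
    refine eq_zero_of_exp_eq_one (by fun_prop) (fun z => ?_) (by simp [hB])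
    have h1 := key w z
    simp only [hRz, map_mul, ← Complex.exp_conj, Complex.conj_conj, Complex.conj_ofReal] at h1
    rw [mul_assoc, mul_assoc, ← Complex.exp_add, ← Complex.exp_add] at h1
    rw [Complex.exp_sub, mul_left_cancel₀ hC0 h1, div_self (Complex.exp_ne_zero _)]
  have h1 := hL 1
  simp only [map_one, one_mul] at h1
  obtain ⟨A, hA⟩ := Complex.conj_eq_iff_real.1 (show conj (φ 1 - B) = φ 1 - B by
    rw [map_sub]
    linear_combination -h1 1)
  refine ⟨A, C, B, by exact_mod_cast hC0, fun z => ?_, fun z => ?_⟩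
  · have hA' : conj (φ 1) - conj B = A := by rw [← map_sub, hA, Complex.conj_ofReal]
    linear_combination h1 z + z * hA'
  · rw [hPR, hRz]
    ring

/-! ### Kernel pairs in the adjoint -/

/-- The function `z ↦ c * z ^ m * exp (conj w * z)` as an element of the Fock space. -/
noncomputable def kernelElt (c : ℂ) (m : ℕ) (w : ℂ) : FockSpace :=
  c • ⟨fun z => z ^ m * Complex.exp (conj w * z), pow_mul_exp_mem m (conj w)⟩

theorem kernelElt_apply (c : ℂ) (m : ℕ) (w z : ℂ) :
    (kernelElt c m w : ℂ → ℂ) z = c * (z ^ m * Complex.exp (conj w * z)) := rfl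

theorem pairing_const_mul_left (c : ℂ) (f g : ℂ → ℂ) :
    pairing (fun z => c * f z) g = c * pairing f g := by
  unfold pairing
  rw [← integral_const_mul]
  congr 1
  ext z
  ring

theorem pairing_const_mul_right (c : ℂ) (f g : ℂ → ℂ) :
    pairing f (fun z => c * g z) = conj c * pairing f g := by
  rw [← pairing_conj_symm, pairing_const_mul_left, map_mul, pairing_conj_symm]

theorem fockInner_eq (f g : FockSpace) : fockInner f g = (Real.pi : ℂ)⁻¹ * pairing f g := rfl

theorem fockInner_kernelElt (f : FockSpace) (c : ℂ) (m : ℕ) (w : ℂ) :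
    fockInner f (kernelElt c m w) = conj c * iteratedDeriv m (f : ℂ → ℂ) w := by
  have h1 : (kernelElt c m w : ℂ → ℂ) = fun z => c * (z ^ m * Complex.exp (conj w * z)) := rfl
  have hπ : (Real.pi : ℂ) ≠ 0 := by exact_mod_cast Real.pi_ne_zero
  rw [fockInner_eq, h1, pairing_const_mul_right c _ fun z => z ^ m * Complex.exp (conj w * z),
    pairing_kernel f.2]
  field_simp

/-- The kernel pair at w represents the defining equation at w, so it belongs to the adjoint and, by
hermiticity, to S. Applying the defining equation to this pair at z gives the identity. -/
theorem functional_equation {m : ℕ} {ψ φ χ : ℂ → ℂ} {S : MultiOp}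
    (hS : IsWeightedCompOp m ψ φ χ S) (hherm : IsHermitian S) (z w : ℂ) :
    ψ z * φ z ^ m * conj (χ w) * Complex.exp (conj w * φ z) =
      χ z * conj (ψ w * φ w ^ m) * Complex.exp (conj (φ w) * z) := by
  have h1 : (kernelElt (conj (χ w)) m w, kernelElt (conj (ψ w)) 0 (φ w)) ∈
      adjointGraph S id := fun q hq => by
    simp only [id, fockInner_kernelElt, Complex.conj_conj, iteratedDeriv_zero]
    exact (hS hq w).symm
  rw [hherm] at h1
  have h2 := hS h1 z
  have h3 : (kernelElt (conj (ψ w)) 0 (φ w) : ℂ → ℂ) =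
      fun z => conj (ψ w) * Complex.exp (conj (φ w) * z) := by
    ext z
    rw [kernelElt_apply, pow_zero, one_mul]
  simp only [kernelElt_apply, h3, iteratedDeriv_const_mul_field, iteratedDeriv_cexp_const_mul] at h2
  rw [map_mul, map_pow]
  linear_combination h2

/-! ### Symmetry and conjugation invariance of the maximal operator -/

/-- The equation `C exp(z conj B) f(Az + B) = (Az + B)^m g^{(m)}(z)`. -/
def ReducedEq (m : ℕ) (A C : ℝ) (B : ℂ) (f g : ℂ → ℂ) : Prop :=
  ∀ z, C * Complex.exp (z * conj B) * f (A * z + B) = (A * z + B) ^ m * iteratedDeriv m g z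

theorem mem_maxOp_iff {m : ℕ} {ψ φ χ : ℂ → ℂ} {A C : ℝ} {B : ℂ} (hψ : ∀ z, ψ z ≠ 0) (hC : C ≠ 0)
    (hφ : ∀ z, φ z = A * z + B)
    (hχ : ∀ z, C * Complex.exp (z * conj B) * χ z = ψ z * (A * z + B) ^ m)
    (p : FockSpace × FockSpace) : p ∈ maxOp m ψ φ χ ↔ ReducedEq m A C B p.1 p.2 := by
  have hC' : ∀ z, (C : ℂ) * Complex.exp (z * conj B) ≠ 0 := fun z =>
    mul_ne_zero (by exact_mod_cast hC) (Complex.exp_ne_zero _)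
  refine forall_congr' fun z => ?_
  rw [hφ]
  constructor
  · intro h
    refine mul_left_cancel₀ (hψ z) ?_
    linear_combination (C * Complex.exp (z * conj B)) * h +
      iteratedDeriv m (p.2 : ℂ → ℂ) z * hχ z
  · intro h
    refine mul_left_cancel₀ (hC' z) ?_
    linear_combination ψ z * h - iteratedDeriv m (p.2 : ℂ → ℂ) z * hχ z

/-- Substitute y = (z - B)/A: the factor exp(-y conj(B)) splits into the constant exp(|B|²/A) and
the exponential with β = -B/A. -/
theorem ReducedEq.eq_weightedDeriv {m : ℕ} {A C : ℝ} {B : ℂ} (hA : A ≠ 0) (hC : C ≠ 0)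
    {f g : ℂ → ℂ} (h : ReducedEq m A C B f g) :
    f = fun z => ((C⁻¹ * Real.exp (‖B‖ ^ 2 / A) : ℝ) : ℂ) * weightedDeriv m A⁻¹ (-B / A) g z := by
  have hA' : (A : ℂ) ≠ 0 := by exact_mod_cast hA
  have hC' : (C : ℂ) ≠ 0 := by exact_mod_cast hC
  ext z
  set y : ℂ := ((A⁻¹ : ℝ) : ℂ) * z + -B / A with hy
  have h1 := h y
  have h2 : (A : ℂ) * y + B = z := by
    rw [hy]
    push_cast
    field_simp
    ring
  rw [h2] at h1
  have h3 : Complex.exp (y * conj B) * (((Real.exp (‖B‖ ^ 2 / A) : ℝ) : ℂ) *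
      Complex.exp (conj (-B / A) * z)) = 1 := by
    rw [Complex.ofReal_exp, ← Complex.exp_add, ← Complex.exp_add, Complex.exp_eq_one_iff]
    refine ⟨0, ?_⟩
    rw [hy]
    push_cast
    rw [← Complex.mul_conj', map_div₀, map_neg, Complex.conj_ofReal]
    field_simp
    ring
  rw [weightedDeriv, weightedCore, ← hy]
  refine mul_left_cancel₀ (mul_ne_zero hC' (Complex.exp_ne_zero (y * conj B))) ?_
  rw [h1]
  push_cast at h3 ⊢
  have h4 : (C : ℂ) * (C : ℂ)⁻¹ = 1 := mul_inv_cancel₀ hC'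
  linear_combination (-(z ^ m * iteratedDeriv m g y)) * h3 * (C * (C : ℂ)⁻¹) -
    (z ^ m * iteratedDeriv m g y) * h4

/-- If A = 0, then m = 0 and g = C f(B) K_B with K_B the kernel at B, so symmetry reduces to C being
real. If A ≠ 0, then f is a real multiple of `weightedDeriv` applied to g, and
`pairing_weightedDeriv` applies. -/
theorem ReducedEq.pairing_eq {m : ℕ} {A C : ℝ} {B : ℂ} (hA : A = 0 → m = 0) (hC : C ≠ 0)
    {f g u v : ℂ → ℂ} (hf : f ∈ FockSpace) (hg : g ∈ FockSpace) (hu : u ∈ FockSpace)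
    (hv : v ∈ FockSpace) (h : ReducedEq m A C B f g) (h' : ReducedEq m A C B u v) :
    pairing g u = pairing f v := by
  by_cases hA0 : A = 0
  · obtain rfl := hA hA0
    subst hA0
    have form : ∀ {f g : ℂ → ℂ}, ReducedEq 0 0 C B f g →
        g = fun z => (C * f B) * Complex.exp (conj B * z) := fun {f g} h => by
      ext z
      have := h z
      simp only [Complex.ofReal_zero, zero_mul, zero_add, pow_zero, one_mul,
        iteratedDeriv_zero] at this
      rw [← this, mul_comm z]
      ring
    have k : ∀ {f : ℂ → ℂ}, f ∈ FockSpace →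
        pairing f (fun z => Complex.exp (conj B * z)) = Real.pi * f B := fun hf => by
      simpa using pairing_kernel hf 0 B
    rw [form h, form h', pairing_const_mul_left, pairing_const_mul_right, ← pairing_conj_symm,
      k hu, k hf]
    simp only [map_mul, Complex.conj_ofReal]
    ring
  · set c : ℝ := C⁻¹ * Real.exp (‖B‖ ^ 2 / A) with hc
    have hc0 : (c : ℂ) ≠ 0 := by
      have : c ≠ 0 := mul_ne_zero (inv_ne_zero hC) (Real.exp_ne_zero _)
      exact_mod_cast this
    have form : ∀ {f g : ℂ → ℂ}, f ∈ FockSpace → ReducedEq m A C B f g →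
        weightedDeriv m A⁻¹ (-B / A) g ∈ FockSpace := fun {f g} hf h => by
      have h1 := FockSpace.smul_mem (c : ℂ)⁻¹ hf
      convert h1 using 1
      rw [h.eq_weightedDeriv hA0 hC]
      ext z
      simp only [Pi.smul_apply, smul_eq_mul]
      rw [inv_mul_cancel_left₀ hc0]
    have key := pairing_weightedDeriv (inv_ne_zero hA0) hv (form hu h') hg (form hf h)
    rw [h.eq_weightedDeriv hA0 hC, h'.eq_weightedDeriv hA0 hC, pairing_const_mul_left,
      pairing_const_mul_right, key, Complex.conj_ofReal]

/-! ### Conjugation invariance and identification of S with the maximal operator. -/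

theorem iteratedDeriv_conj_conj {f : ℂ → ℂ} (m : ℕ) :
    iteratedDeriv m (fun z => conj (f (conj z))) = fun z => conj (iteratedDeriv m f (conj z)) := by
  induction m with
  | zero => simp
  | succ m ih =>
    ext z
    rw [iteratedDeriv_succ, ih, iteratedDeriv_succ]
    have := congrFun (deriv_conj_conj (f := iteratedDeriv m f)) z
    simpa [Function.comp_def] using this

theorem reducedEq_conj_iff {m : ℕ} {A C : ℝ} {B a : ℂ} (ha : ‖a‖ = 1) (haB : a * B = conj B)
    {f g : ℂ → ℂ} (hg : Differentiable ℂ g) :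
    ReducedEq m A C B (fun z => conj (f (conj (a * z)))) (fun z => conj (g (conj (a * z)))) ↔
      ReducedEq m A C B f g := by
  have haa : a * conj a = 1 := by
    rw [Complex.mul_conj, Complex.normSq_eq_norm_sq, ha]
    simp
  have hd : iteratedDeriv m (fun z => conj (g (conj (a * z)))) =
      fun z => a ^ m * conj (iteratedDeriv m g (conj (a * z))) := by
    have h1 := iteratedDeriv_comp_affine (differentiable_conj_conj hg) a 0 m
    simp only [add_zero, iteratedDeriv_conj_conj] at h1
    exact h1
  have haB' : conj a * conj B = B := by
    have := congrArg conj haB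
    simpa using this
  have hz : ∀ y : ℂ, (C * Complex.exp (conj a * conj y * conj B) *
      conj (f (conj (a * (A * (conj a * conj y) + B)))) =
      (A * (conj a * conj y) + B) ^ m *
        iteratedDeriv m (fun z => conj (g (conj (a * z)))) (conj a * conj y)) ↔
      C * Complex.exp (y * conj B) * f (A * y + B) = (A * y + B) ^ m * iteratedDeriv m g y := by
    intro y
    have e1 : conj (a * (A * (conj a * conj y) + B)) = A * y + B := by
      have : a * (A * (conj a * conj y) + B) = conj (A * y + B) := by
        simp only [map_add, map_mul, Complex.conj_ofReal]
        linear_combination (A * conj y) * haa + haB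
      rw [this, Complex.conj_conj]
    have e2 : (A * (conj a * conj y) + B) ^ m * a ^ m = conj ((A * y + B) ^ m) := by
      rw [← mul_pow, map_pow]
      congr 1
      simp only [map_add, map_mul, Complex.conj_ofReal]
      linear_combination (A * conj y) * haa + haB
    have e3 : conj (a * (conj a * conj y)) = y := by
      rw [← mul_assoc, haa, one_mul, Complex.conj_conj]
    have e4 : Complex.exp (conj a * conj y * conj B) = conj (Complex.exp (y * conj B)) := by
      rw [← Complex.exp_conj, map_mul, Complex.conj_conj]
      congr 1
      linear_combination conj y * haB'
    rw [hd, e1]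
    simp only [e3]
    rw [e4, ← mul_assoc ((A * (conj a * conj y) + B) ^ m), e2]
    have e5 : C * conj (Complex.exp (y * conj B)) * conj (f (A * y + B)) =
        conj (C * Complex.exp (y * conj B) * f (A * y + B)) := by
      simp only [map_mul, Complex.conj_ofReal]
    rw [e5, ← map_mul]
    exact (starRingEnd ℂ).injective.eq_iff
  constructor
  · intro h y
    exact (hz y).1 (h (conj a * conj y))
  · intro h z
    have := (hz (conj (a * z))).2 (h _)
    rwa [Complex.conj_conj, ← mul_assoc, mul_comm (conj a), haa, one_mul] at this

/-- Symmetry of the maximal operator M and S ⊆ M place M inside M* ⊆ S* = S. -/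
theorem isHermitian_eq_maxOp {m : ℕ} {ψ φ χ : ℂ → ℂ} {A C : ℝ} {B : ℂ} (hψ : ∀ z, ψ z ≠ 0)
    (hC : C ≠ 0) (hφ : ∀ z, φ z = A * z + B) (hA : A = 0 → m = 0)
    (hχ : ∀ z, C * Complex.exp (z * conj B) * χ z = ψ z * (A * z + B) ^ m) {S : MultiOp}
    (hS : IsWeightedCompOp m ψ φ χ S) (hherm : IsHermitian S) : S = maxOp m ψ φ χ := by
  refine le_antisymm hS fun p hp => ?_
  change p ∈ (S : Set (FockSpace × FockSpace))
  rw [← hherm]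
  intro q hq
  have h1 := (mem_maxOp_iff hψ hC hφ hχ p).1 hp
  have h2 := (mem_maxOp_iff hψ hC hφ hχ q).1 (hS hq)
  rw [fockInner_eq, fockInner_eq, id, id, h2.pairing_eq hA hC q.1.2 q.2.2 p.1.2 p.2.2 h1]

theorem isCSelfadjoint_of_isHermitian {m : ℕ} {ψ φ χ : ℂ → ℂ} {A C : ℝ} {B : ℂ}
    (hψ : ∀ z, ψ z ≠ 0) (hC : C ≠ 0) (hφ : ∀ z, φ z = A * z + B) (hA : A = 0 → m = 0)
    (hχ : ∀ z, C * Complex.exp (z * conj B) * χ z = ψ z * (A * z + B) ^ m) {S : MultiOp}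
    (hS : IsWeightedCompOp m ψ φ χ S) (hherm : IsHermitian S) {a : ℂ} (ha : ‖a‖ = 1)
    (haB : a * B = conj B) : IsCSelfadjoint a 0 1 S := by
  have hp : ConjParams a 0 1 := ⟨ha, by simp, by simp⟩
  have hmax := isHermitian_eq_maxOp hψ hC hφ hA hχ hS hherm
  have hT : ∀ f : FockSpace, (weightedConj hp f : ℂ → ℂ) =
      fun z => conj ((f : ℂ → ℂ) (conj (a * z))) := fun f => by
    ext z
    simp [weightedConj]
  refine ⟨hp, Set.ext fun p => ?_⟩
  -- The T-adjoint is by definition the preimage of the ordinary adjoint under T × T.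
  have h1 : p ∈ adjointGraph S (weightedConj hp) ↔
      (weightedConj hp p.1, weightedConj hp p.2) ∈ adjointGraph S id := Iff.rfl
  rw [h1, hherm, SetLike.mem_coe, SetLike.mem_coe, hmax, mem_maxOp_iff hψ hC hφ hχ,
    mem_maxOp_iff hψ hC hφ hχ]
  simp only [hT]
  exact reducedEq_conj_iff ha haB p.2.2.1

end Fock

theorem mainTheorem7 (m : ℕ) (ψ φ χ : ℂ → ℂ)
    (hψ : Differentiable ℂ ψ) (hφ : Differentiable ℂ φ) (hχ : Differentiable ℂ χ)
    (hψ_ne : ∀ z, ψ z ≠ 0) (hχ_ne : ∃ z, χ z ≠ 0)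
    (hφ_nonconst : 1 ≤ m → ¬ ∃ w : ℂ, ∀ z, φ z = w)
    (S : Fock.MultiOp) (hS : Fock.IsWeightedCompOp m ψ φ χ S)
    (hherm : Fock.IsHermitian S) :
    ∃ (A C : ℝ) (B : ℂ), C ≠ 0 ∧
      (∀ z : ℂ, φ z = A * z + B) ∧
      (∀ z : ℂ, C * Complex.exp (z * conj B) * χ z = ψ z * (A * z + B) ^ m) ∧
      (B ≠ 0 → Fock.IsCSelfadjoint (conj B / B) 0 1 S) ∧
      (B = 0 → Fock.IsCSelfadjoint 1 0 1 S) := by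
  -- For m ≥ 1, vanishing of ψ φ^m would force φ ≡ 0, a constant.
  have hP0 : ∃ z, ψ z * φ z ^ m ≠ 0 := by
    rcases Nat.eq_zero_or_pos m with rfl | hm
    · exact ⟨0, by simpa using hψ_ne 0⟩
    · by_contra! h
      exact hφ_nonconst hm ⟨0, fun z =>
        eq_zero_of_pow_eq_zero ((mul_eq_zero.1 (h z)).resolve_left (hψ_ne z))⟩
  obtain ⟨A, C, B, hC, hφz, hχz⟩ := Fock.symbols_of_functional_equation hφ hχ hP0 hχ_ne
    (Fock.functional_equation hS hherm)
  have hχz' : ∀ z, C * Complex.exp (z * conj B) * χ z = ψ z * (A * z + B) ^ m := fun z => by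
    rw [hχz, hφz]
  have hA : A = 0 → m = 0 := by
    rintro rfl
    by_contra hm
    exact hφ_nonconst (Nat.one_le_iff_ne_zero.2 hm) ⟨B, fun z => by simp [hφz]⟩
  refine ⟨A, C, B, hC, hφz, hχz', fun hB => ?_, fun hB => ?_⟩
  · refine Fock.isCSelfadjoint_of_isHermitian hψ_ne hC hφz hA hχz' hS hherm ?_
      (div_mul_cancel₀ _ hB)
    rw [norm_div, RCLike.norm_conj, div_self (norm_ne_zero_iff.2 hB)]
  · exact Fock.isCSelfadjoint_of_isHermitian hψ_ne hC hφz hA hχz' hS hherm norm_one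
      (by simp [hB])
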